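/- Identify $\mathbb R^{12}$ with $\mathbb H^3$, $\mathbb H$ being the Hamilton quaternions, write $x=(\omega_1,\omega_2,\omega_3)$ and set $$w(x)=\frac{\operatorname{Re}(\omega_1\omega_2\omega_3)}{|x|}\quad(x\neq0),\qquad w(0)=0 .$$ Let $\Omega$ be the open unit ball of $\mathbb R^{12}$. For a smooth function $F$ on the space of symmetric $12\times12$ matrices, uniform ellipticity means that for some $\Lambda\ge1$ $$\Lambda^{-1}|\xi|^2\le F_{u_{ij}}(A)\,\xi_i\xi_j\le\Lambda|\xi|^2\quad\text{for all symmetric }A\text{ and all }\xi\in\mathbb R^{12}.$$ A viscosity solution of $F(D^2u)=0$ in $\Omega$ is a continuous function $u$ on $\Omega$ such that for every $v\in C^2(\Omega)$ and every domain $G$ with $\overline G\subset\Omega$: if $F(D^2v)\ge0$ in $G$ and $v\le u$ on $\partial G$, then $v\le u$ in $G$; and if $F(D^2v)\le0$ in $G$ and $v\ge u$ on $\partial G$, then $v\ge u$ in $G$. The function $w$ is $C^\infty$ in $\mathbb R^{12}\setminus\{0\}$, and its second derivatives are discontinuous at $0$: $D^2w(x)$ has no limit as $x\to0$, $x\ne0$.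 Moreover, there exists a $C^\infty$ uniformly elliptic function $F$ on the space of symmetric $12\times 12$ matrices such that, for the Dirichlet problem $$F(D^2u)=0\ \text{ in }\Omega,\qquad u=w\ \text{ on }\partial\Omega,$$ (i) $w$ is a viscosity solution, and it is the only viscosity solution that is continuous on $\overline\Omega$; (ii) there is no classical solution, that is, no $u\in C^2(\Omega)\cap C(\overline\Omega)$ satisfying both conditions. -/

import Mathlib

set_option maxSynthPendingDepth 3

open Set Metric Filter Topology
open scoped ContDiff Quaternion

noncomputable section

namespace FullyNonlinear

/-- Euclidean space `ℝⁿ`. -/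
abbrev E (n : ℕ) : Type := EuclideanSpace ℝ (Fin n)

/-- The space of quadratic forms on `ℝⁿ`, i.e. of symmetric bilinear forms (symmetric `n × n`
matrices). -/
def SymForm (n : ℕ) : Submodule ℝ (E n →L[ℝ] E n →L[ℝ] ℝ) where
  carrier := {A | ∀ y z, A y z = A z y}
  add_mem' := by
    intro A B hA hB y z
    simp [hA y z, hB y z]
  zero_mem' := by
    intro y z
    simp
  smul_mem' := by
    intro c A hA y z
    simp [hA y z]

/-- The rank one form `ξ ⊗ ξ : (y, z) ↦ ⟨ξ, y⟩ ⟨ξ, z⟩`, with matrix `(ξ_i ξ_j)`. -/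
def rankOne {n : ℕ} (ξ : E n) : SymForm n :=
  ⟨(innerSL ℝ ξ).smulRight (innerSL ℝ ξ), by
    intro y z
    simp [mul_comm]⟩

/-- The Hessian `D²u(x)`, as a symmetric bilinear form. The symmetrization only serves to make
the value symmetric at points where `u` is not `C²`; see `coe_hess`. -/
def hess {n : ℕ} (u : E n → ℝ) (x : E n) : SymForm n :=
  ⟨(1 / 2 : ℝ) • (fderiv ℝ (fderiv ℝ u) x + (fderiv ℝ (fderiv ℝ u) x).flip), by
    intro y z
    simp [add_comm]⟩

/-- Where `u` is `C²`, the Hessian is the second Fréchet derivative. -/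
theorem coe_hess {n : ℕ} {u : E n → ℝ} {x : E n} (hu : ContDiffAt ℝ 2 u x) :
    (hess u x : E n →L[ℝ] E n →L[ℝ] ℝ) = fderiv ℝ (fderiv ℝ u) x := by
  have h : IsSymmSndFDerivAt ℝ u x := hu.isSymmSndFDerivAt (by simp)
  ext y z
  have hyz := h y z
  simp only [hess, smul_apply, add_apply, ContinuousLinearMap.flip_apply,
    smul_eq_mul]
  rw [hyz]
  ring

/-- Uniform ellipticity of a differentiable `F`:
`Λ⁻¹ |ξ|² ≤ F_{u_{ij}} ξ_i ξ_j ≤ Λ |ξ|²` everywhere, for some constant `Λ ≥ 1`. -/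
def UniformlyElliptic {n : ℕ} (F : SymForm n → ℝ) : Prop :=
  ∃ Λ : ℝ, 1 ≤ Λ ∧ ∀ (A : SymForm n) (ξ : E n),
    Λ⁻¹ * ‖ξ‖ ^ 2 ≤ fderiv ℝ F A (rankOne ξ) ∧ fderiv ℝ F A (rankOne ξ) ≤ Λ * ‖ξ‖ ^ 2

/-- `u` is a classical solution of the Dirichlet problem `F(D²u) = 0` in `Ω`, `u = φ` on `∂Ω`. -/
def IsClassicalDirichletSolution {n : ℕ} (F : SymForm n → ℝ) (Ω : Set (E n)) (φ u : E n → ℝ) :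
    Prop :=
  ContDiffOn ℝ 2 u Ω ∧ ContinuousOn u (closure Ω) ∧
    (∀ x ∈ Ω, F (hess u x) = 0) ∧ ∀ x ∈ frontier Ω, u x = φ x

/-- `u` is a viscosity solution of `F(D²u) = 0` in `Ω`: `u` is continuous in `Ω` and satisfies
the comparison principle against every `C²` function `v` on every subdomain `G ⋐ Ω`. -/
def IsViscositySolution {n : ℕ} (F : SymForm n → ℝ) (Ω : Set (E n)) (u : E n → ℝ) : Prop :=
  ContinuousOn u Ω ∧
    ∀ v : E n → ℝ, ContDiffOn ℝ 2 v Ω →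
      ∀ G : Set (E n), IsOpen G → IsConnected G → IsCompact (closure G) → closure G ⊆ Ω →
        (((∀ x ∈ G, 0 ≤ F (hess v x)) → (∀ x ∈ frontier G, v x ≤ u x) →
            ∀ x ∈ G, v x ≤ u x) ∧
          ((∀ x ∈ G, F (hess v x) ≤ 0) → (∀ x ∈ frontier G, u x ≤ v x) →
            ∀ x ∈ G, u x ≤ v x))

/-- `u` is a viscosity solution of the Dirichlet problem `F(D²u) = 0` in `Ω`, `u = φ` on `∂Ω`. -/
def IsViscosityDirichletSolution {n : ℕ} (F : SymForm n → ℝ) (Ω : Set (E n))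
    (φ u : E n → ℝ) : Prop :=
  IsViscositySolution F Ω u ∧ ContinuousOn u (closure Ω) ∧ ∀ x ∈ frontier Ω, u x = φ x

/-- The `j`-th quaternionic coordinate, `j = 0, 1, 2`, under the identification `ℝ¹² = ℍ³`. -/
def quat (x : E 12) (j : Fin 3) : ℍ[ℝ] :=
  ⟨x (finProdFinEquiv (j, (0 : Fin 4))), x (finProdFinEquiv (j, (1 : Fin 4))),
    x (finProdFinEquiv (j, (2 : Fin 4))), x (finProdFinEquiv (j, (3 : Fin 4)))⟩

/-- `w(x) = Re(ω₁ ω₂ ω₃) / |x|` for `x = (ω₁, ω₂, ω₃) ∈ ℍ³ = ℝ¹²`; the convention `0 / 0 = 0`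
gives the continuous extension `w(0) = 0`. -/
def w (x : E 12) : ℝ := (quat x 0 * quat x 1 * quat x 2).re / ‖x‖

end FullyNonlinear

end

/-! The function `w` is odd, positively homogeneous of degree two and smooth off the origin. Hence
D²w is odd and homogeneous of degree zero: its values off the origin fill the compact set S =
D²w(sphere). A limit at 0 would make D²w constant, and then zero by oddness.

The key fact is `hess_w_hyperbolic`: for unit x, y the form D²w(x) - D²w(y) is at least c|x - y| in
some unit direction. Exchanging x and y also gives a direction where it is at most -c|x - y|, so
distinct values are never ordered, as membership in the zero set of an elliptic function demands. To
prove it, write x = ρm + (s/2)d and y = ρm - (s/2)d with d, m orthonormal. For v orthogonal to both,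
the difference on v is s(2B(d,v) - (ρ²B(d,m) + (s²/4)P(d))|v|²), where P = `cub` and B = `cubB`.
Since ρ² + s²/4 = 1, a v with 2B(d,v) above both B(d,m)|v|² and P(d)|v|² suffices
(`exists_cubB_lt`). Quaternion multiplication supplies four dimensional spaces on which 2B(d,·) is
|d_j||v|², large enough to meet two orthogonality conditions. The only exceptional configuration is
an equality case treated by hand in `exists_of_norm_le`.

A hyperbolic compact set lies in the zero set of a Lipschitz uniformly elliptic function, an infimum
of translated Pucci type operators (`exists_lipschitz_elliptic`). Near S there is also a smooth
elliptic function vanishing on S: the range of the derivative of D²w contains no nonzero positive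
semidefinite form, so a positive definite functional annihilates it
(`HyperbolicMap.exists_functional`, `HyperbolicMap.exists_local`). A logarithmic cutoff, whose
derivative is small compared with the inverse distance to S, glues this function to a mollification
of the Lipschitz one (`exists_uniformlyElliptic`).

For such an F, a C² function touching `w` from below at 0 has Hessian below some D²w(e), so `w` is a
viscosity solution (`Profile.not_isLocalMax`). For uniqueness, a solution v exceeding `w` somewhere
is compared with all small translates of `w`. Contact is forced at the singularity of each
translate, so v plus a small multiple of |x|² is constant near 0, and `w` would be nonnegative
there, contrary to oddness (`Profile.le_of_liesBelow`). A classical solution would be a viscosity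
solution, hence equal to `w`, which is not C² at 0. -/

noncomputable section

namespace FullyNonlinear

variable {n : ℕ}

/-! ### Symmetric forms, rank one forms and the trace -/

/-- The evaluation `A ↦ A(v, v)` as a continuous linear functional. -/
def qfL (v : E n) : SymForm n →L[ℝ] ℝ :=
  ((ContinuousLinearMap.apply ℝ ℝ v).comp
    (ContinuousLinearMap.apply ℝ (E n →L[ℝ] ℝ) v)).comp (SymForm n).subtypeL

/-- The quadratic form of a symmetric bilinear form. -/
def qf (A : SymForm n) (v : E n) : ℝ := qfL v A

theorem qf_apply (A : SymForm n) (v : E n) : qf A v = (A : E n →L[ℝ] E n →L[ℝ] ℝ) v v := rfl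

@[simp] theorem qf_add (A B : SymForm n) (v : E n) : qf (A + B) v = qf A v + qf B v := by
  simp [qf]
@[simp] theorem qf_sub (A B : SymForm n) (v : E n) : qf (A - B) v = qf A v - qf B v := by
  simp [qf]
@[simp] theorem qf_neg (A : SymForm n) (v : E n) : qf (-A) v = - qf A v := by
  simp [qf]
@[simp] theorem qf_smul (c : ℝ) (A : SymForm n) (v : E n) : qf (c • A) v = c * qf A v := by
  simp [qf]
@[simp] theorem qf_zero (v : E n) : qf (0 : SymForm n) v = 0 := by
  simp [qf]
theorem qf_sum {ι : Type*} (s : Finset ι) (A : ι → SymForm n) (v : E n) :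
    qf (∑ i ∈ s, A i) v = ∑ i ∈ s, qf (A i) v := by
  simp [qf]
theorem qf_smul_right (A : SymForm n) (c : ℝ) (v : E n) : qf A (c • v) = c ^ 2 * qf A v := by
  simp only [qf_apply, map_smul, smul_apply, smul_eq_mul]; ring

@[simp] theorem qf_rankOne (ξ v : E n) : qf (rankOne ξ) v = inner ℝ ξ v ^ 2 := by
  simp [qf_apply, rankOne, sq]

theorem qf_symm (A : SymForm n) (y z : E n) :
    (A : E n →L[ℝ] E n →L[ℝ] ℝ) y z = (A : E n →L[ℝ] E n →L[ℝ] ℝ) z y := A.2 y z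

theorem ext_qf {A B : SymForm n} (h : ∀ v, qf A v = qf B v) : A = B := by
  ext y z
  have h1 := h (y + z)
  have h2 := h y
  have h3 := h z
  simp only [qf_apply, map_add, add_apply] at h1 h2 h3
  have h4 := qf_symm A y z
  have h5 := qf_symm B y z
  linarith

theorem abs_qf_le (A : SymForm n) (v : E n) : |qf A v| ≤ ‖A‖ * ‖v‖ ^ 2 := by
  rw [qf_apply, ← Real.norm_eq_abs, sq, ← mul_assoc]
  exact (A : E n →L[ℝ] E n →L[ℝ] ℝ).le_opNorm₂ v v

theorem norm_rankOne_le (ξ : E n) : ‖rankOne ξ‖ ≤ ‖ξ‖ ^ 2 := by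
  refine ContinuousLinearMap.opNorm_le_bound₂ _ (by positivity) fun y z => ?_
  change ‖((innerSL ℝ ξ).smulRight (innerSL ℝ ξ) : E n →L[ℝ] E n →L[ℝ] ℝ) y z‖ ≤ _
  simp only [ContinuousLinearMap.smulRight_apply, innerSL_apply_apply,
    smul_apply, smul_eq_mul, norm_mul]
  calc ‖inner ℝ ξ y‖ * ‖inner ℝ ξ z‖ ≤ (‖ξ‖ * ‖y‖) * (‖ξ‖ * ‖z‖) := by
        gcongr <;> exact norm_inner_le_norm _ _
    _ = ‖ξ‖ ^ 2 * ‖y‖ * ‖z‖ := by ring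

theorem rankOne_smul (c : ℝ) (ξ : E n) : rankOne (c • ξ) = c ^ 2 • rankOne ξ := by
  apply ext_qf; intro v; simp [inner_smul_left]; ring

/-- The identity form `(y, z) ↦ ⟨y, z⟩`. -/
def idForm : SymForm n := ⟨innerSL ℝ, fun y z => real_inner_comm z y⟩

@[simp] theorem qf_idForm (v : E n) : qf idForm v = ‖v‖ ^ 2 := by
  exact real_inner_self_eq_norm_sq v

theorem idForm_eq_sum :
    (idForm : SymForm n) = ∑ i, rankOne (EuclideanSpace.basisFun (Fin n) ℝ i) := by
  apply ext_qf; intro v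
  rw [qf_sum, qf_idForm, ← (EuclideanSpace.basisFun (Fin n) ℝ).sum_sq_inner_right v]
  simp

/-- The trace. -/
def trL : SymForm n →L[ℝ] ℝ := ∑ i, qfL (EuclideanSpace.basisFun (Fin n) ℝ i)

theorem trL_apply (A : SymForm n) :
    trL A = ∑ i, qf A (EuclideanSpace.basisFun (Fin n) ℝ i) := by
  simp [trL, qf]

theorem trL_rankOne (ξ : E n) : trL (rankOne ξ) = ‖ξ‖ ^ 2 := by
  rw [trL_apply, ← (EuclideanSpace.basisFun (Fin n) ℝ).sum_sq_inner_left ξ]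
  simp

theorem abs_trL_le (A : SymForm n) : |trL A| ≤ n * ‖A‖ := by
  rw [trL_apply]
  refine (Finset.abs_sum_le_sum_abs _ _).trans ?_
  refine (Finset.sum_le_sum fun i _ => abs_qf_le A _).trans ?_
  simp

/-- A positive semidefinite form is a sum of rank one forms. -/
theorem exists_sum_rankOne {A : SymForm n} (hA : ∀ v, 0 ≤ qf A v) :
    ∃ (ι : Type) (_ : Fintype ι) (ξ : ι → E n), A = ∑ i, rankOne (ξ i) := by
  let B : LinearMap.BilinForm ℝ (E n) :=
    LinearMap.mk₂ ℝ (fun y z => (A : E n →L[ℝ] E n →L[ℝ] ℝ) y z) (by simp) (by simp) (by simp)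
      (by simp)
  have hB : LinearMap.IsSymm B := ⟨fun y z => A.2 y z⟩
  obtain ⟨b, hb⟩ := LinearMap.BilinForm.exists_orthogonal_basis hB
  -- In a basis orthogonal for A, A(v,v) is the sum of A(b_i,b_i) times squared coordinates, and
  -- each coordinate functional is represented by a vector through the inner product.
  refine ⟨Fin (Module.finrank ℝ (E n)), inferInstance, fun i => Real.sqrt (qf A (b i)) •
    (InnerProductSpace.toDual ℝ (E n)).symm (LinearMap.toContinuousLinearMap (b.coord i)), ?_⟩
  apply ext_qf
  intro v
  rw [qf_sum]
  simp only [rankOne_smul, qf_smul, Real.sq_sqrt (hA _), qf_rankOne,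
    InnerProductSpace.toDual_symm_apply, LinearMap.coe_toContinuousLinearMap', Module.Basis.coord_apply]
  have h1 : qf A v = B v v := rfl
  have h2 : B v v = ∑ i, ∑ j, b.repr v i * (b.repr v j * B (b i) (b j)) := by
    conv_lhs => rw [← b.sum_repr v]
    simp only [map_sum, LinearMap.sum_apply, map_smul, LinearMap.smul_apply, smul_eq_mul]
    rw [Finset.sum_comm]
    simp only [Finset.mul_sum]
    refine Finset.sum_congr rfl fun i _ => Finset.sum_congr rfl fun j _ => ?_
    ring
  rw [h1, h2]
  refine Finset.sum_congr rfl fun i _ => ?_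
  rw [Finset.sum_eq_single i]
  · have : qf A (b i) = B (b i) (b i) := rfl
    rw [this]; ring
  · intro j _ hj
    have : B (b i) (b j) = 0 := hb hj.symm
    simp [this]
  · simp

theorem nonneg_of_rankOne {ℓ : SymForm n →L[ℝ] ℝ} (hℓ : ∀ ξ, 0 ≤ ℓ (rankOne ξ)) {A : SymForm n}
    (hA : ∀ v, 0 ≤ qf A v) : 0 ≤ ℓ A := by
  obtain ⟨ι, _, ξ, rfl⟩ := exists_sum_rankOne hA
  rw [map_sum]
  exact Finset.sum_nonneg fun i _ => hℓ _

/-- Makes the positive semidefinite forms of trace one a bounded set, hence a compact base of the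
positive cone. -/
theorem norm_le_trL {A : SymForm n} (hA : ∀ v, 0 ≤ qf A v) : ‖A‖ ≤ trL A := by
  obtain ⟨ι, _, ξ, rfl⟩ := exists_sum_rankOne hA
  rw [map_sum]
  exact norm_sum_le_of_le _ fun i _ => by rw [trL_rankOne]; exact norm_rankOne_le _

/-! ### Ellipticity and monotonicity -/

/-- A differentiable `F` that is strictly increasing in the direction of rank one forms. -/
def Elliptic (F : SymForm n → ℝ) : Prop :=
  Differentiable ℝ F ∧ ∀ A ξ, ξ ≠ 0 → 0 < fderiv ℝ F A (rankOne ξ)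

theorem UniformlyElliptic.elliptic {F : SymForm n → ℝ} (hF : UniformlyElliptic F)
    (hd : Differentiable ℝ F) : Elliptic F := by
  obtain ⟨Λ, hΛ, h⟩ := hF
  refine ⟨hd, fun A ξ hξ => lt_of_lt_of_le ?_ (h A ξ).1⟩
  have : 0 < ‖ξ‖ := norm_pos_iff.2 hξ
  positivity

theorem hasDerivAt_segment {F : SymForm n → ℝ} (hF : Differentiable ℝ F) (A B : SymForm n)
    (t : ℝ) : HasDerivAt (fun t : ℝ => F (A + t • B)) (fderiv ℝ F (A + t • B) B) t := by
  have h1 : HasDerivAt (fun t : ℝ => A + t • B) B t := by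
    simpa using ((hasDerivAt_id t).smul_const B).const_add A
  exact (hF _).hasFDerivAt.comp_hasDerivAt t h1

/-- The derivative of F along the segment from A to B is taken in the direction B - A, a sum of rank
one forms. -/
theorem Elliptic.mono {F : SymForm n → ℝ} (hF : Elliptic F) {A B : SymForm n}
    (h : ∀ v, qf A v ≤ qf B v) : F A ≤ F B := by
  have hBA : ∀ v, 0 ≤ qf (B - A) v := fun v => by simp [h v]
  have key : Monotone fun t : ℝ => F (A + t • (B - A)) := by
    refine monotone_of_hasDerivAt_nonneg (hasDerivAt_segment hF.1 A (B - A)) fun t => ?_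
    refine nonneg_of_rankOne (fun ξ => ?_) hBA
    rcases eq_or_ne ξ 0 with rfl | hξ
    · have : rankOne (0 : E n) = 0 := by apply ext_qf; simp
      simp [this]
    · exact (hF.2 _ ξ hξ).le
  have := key (zero_le_one (α := ℝ))
  simpa using this

theorem Elliptic.lt_add {F : SymForm n → ℝ} (hF : Elliptic F) (hn : 0 < n) (A : SymForm n) {s : ℝ}
    (hs : 0 < s) : F A < F (A + s • idForm) := by
  have key : StrictMono fun t : ℝ => F (A + t • idForm) := by
    refine strictMono_of_hasDerivAt_pos (hasDerivAt_segment hF.1 A idForm) fun t => ?_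
    rw [idForm_eq_sum, map_sum]
    have : Nonempty (Fin n) := ⟨⟨0, hn⟩⟩
    refine Finset.sum_pos (fun i _ => hF.2 _ _ ?_) Finset.univ_nonempty
    exact (EuclideanSpace.basisFun (Fin n) ℝ).orthonormal.ne_zero i
  have := key hs
  simpa using this

/-- The dual operator `A ↦ -F(-A)`. -/
theorem Elliptic.neg {F : SymForm n → ℝ} (hF : Elliptic F) : Elliptic fun A => -F (-A) := by
  have hd : ∀ A, HasFDerivAt (fun A => -F (-A)) (fderiv ℝ F (-A)) A := fun A => by
    have h1 : HasFDerivAt (fun A : SymForm n => -A) (-ContinuousLinearMap.id ℝ (SymForm n)) A :=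
      (hasFDerivAt_id A).neg
    refine ((hF.1 (-A)).hasFDerivAt.comp A h1).neg.congr_fderiv ?_
    ext; simp
  exact ⟨fun A => (hd A).differentiableAt, fun A ξ hξ => by
    rw [(hd A).fderiv]; exact hF.2 _ ξ hξ⟩

/-! ### Calculus of Hessians -/

theorem qf_hess (u : E n → ℝ) (x v : E n) : qf (hess u x) v = fderiv ℝ (fderiv ℝ u) x v v := by
  simp only [qf_apply, hess, smul_apply, add_apply,
    ContinuousLinearMap.flip_apply, smul_eq_mul]
  ring

theorem hess_congr {u w : E n → ℝ} {x : E n} (h : u =ᶠ[𝓝 x] w) : hess u x = hess w x := by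
  apply ext_qf; intro v
  rw [qf_hess, qf_hess, (h.fderiv (𝕜 := ℝ)).fderiv_eq]

theorem hess_neg (u : E n → ℝ) (x : E n) : hess (fun y => -u y) x = -hess u x := by
  apply ext_qf; intro v
  rw [qf_neg, qf_hess, qf_hess]
  have h : fderiv ℝ (fun y => -u y) = fun y => -fderiv ℝ u y := by
    ext1 y; exact fderiv_fun_neg
  rw [h, fderiv_fun_neg]; rfl

theorem differentiableAt_fderiv {u : E n → ℝ} {x : E n} (hu : ContDiffAt ℝ 2 u x) :
    DifferentiableAt ℝ (fderiv ℝ u) x :=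
  (hu.fderiv_right (m := 1) (by norm_num)).differentiableAt (by norm_num)

theorem eventually_differentiableAt {u : E n → ℝ} {x : E n} (hu : ContDiffAt ℝ 2 u x) :
    ∀ᶠ y in 𝓝 x, DifferentiableAt ℝ u y := by
  filter_upwards [hu.eventually (by simp)] with y hy
  exact hy.differentiableAt (by norm_num)

theorem hess_add {u w : E n → ℝ} {x : E n} (hu : ContDiffAt ℝ 2 u x) (hw : ContDiffAt ℝ 2 w x) :
    hess (fun y => u y + w y) x = hess u x + hess w x := by
  apply ext_qf; intro v
  have h : fderiv ℝ (fun y => u y + w y) =ᶠ[𝓝 x] fun y => fderiv ℝ u y + fderiv ℝ w y := by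
    filter_upwards [eventually_differentiableAt hu, eventually_differentiableAt hw] with y h1 h2
    exact fderiv_fun_add h1 h2
  rw [qf_add, qf_hess, qf_hess, qf_hess, h.fderiv_eq,
    fderiv_fun_add (differentiableAt_fderiv hu) (differentiableAt_fderiv hw)]
  rfl

theorem hess_sub {u w : E n → ℝ} {x : E n} (hu : ContDiffAt ℝ 2 u x) (hw : ContDiffAt ℝ 2 w x) :
    hess (fun y => u y - w y) x = hess u x - hess w x := by
  have := hess_add hu hw.neg
  simp only [← sub_eq_add_neg, hess_neg] at this
  exact this

theorem hess_add_const (u : E n → ℝ) (c : ℝ) (x : E n) :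
    hess (fun y => u y + c) x = hess u x := by
  apply ext_qf; intro v
  have h : fderiv ℝ (fun y => u y + c) = fderiv ℝ u := by
    ext1 y; exact fderiv_add_const c
  rw [qf_hess, qf_hess, h]

theorem hess_comp_sub (u : E n → ℝ) (h x : E n) :
    hess (fun y => u (y - h)) x = hess u (x - h) := by
  apply ext_qf; intro v
  have h1 : fderiv ℝ (fun y => u (y - h)) = fun y => fderiv ℝ u (y - h) := by
    ext1 y; exact fderiv_comp_sub h
  rw [qf_hess, qf_hess, h1, fderiv_comp_sub]

theorem contDiff_qf (A : SymForm n) {k : ℕ∞ω} : ContDiff ℝ k (fun y => qf A y) := by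
  simp only [qf_apply]
  fun_prop

theorem hess_qf (A : SymForm n) (x : E n) : hess (fun y => qf A y) x = (2 : ℝ) • A := by
  apply ext_qf; intro v
  have h1 : fderiv ℝ (fun y => qf A y) = fun y => (2 : ℝ) • (A : E n →L[ℝ] E n →L[ℝ] ℝ) y := by
    ext1 y
    refine HasFDerivAt.fderiv ?_
    have h := (A : E n →L[ℝ] E n →L[ℝ] ℝ).hasFDerivAt_of_bilinear (hasFDerivAt_id y)
      (hasFDerivAt_id y)
    refine h.congr_fderiv ?_
    ext z
    change (A : E n →L[ℝ] E n →L[ℝ] ℝ) y z + (A : E n →L[ℝ] E n →L[ℝ] ℝ) z y =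
      2 * (A : E n →L[ℝ] E n →L[ℝ] ℝ) y z
    rw [qf_symm A z y]; ring
  have h2 : HasFDerivAt (fun y => (2 : ℝ) • (A : E n →L[ℝ] E n →L[ℝ] ℝ) y)
    ((2 : ℝ) • (A : E n →L[ℝ] E n →L[ℝ] ℝ)) x :=
    HasFDerivAt.fun_const_smul (A : E n →L[ℝ] E n →L[ℝ] ℝ).hasFDerivAt 2
  rw [qf_hess, h1, h2.fderiv, qf_smul]
  rfl

/-- Differentiating the homogeneity relation twice cancels the factor t². Thus the Hessian of a
profile is determined by its values on the unit sphere. -/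
theorem hess_smul_arg {u : E n → ℝ} {t : ℝ} (ht : 0 < t) (hu : ∀ x, u (t • x) = t ^ 2 * u x)
    (x : E n) : hess u (t • x) = hess u x := by
  apply ext_qf; intro v
  have h1 : fderiv ℝ (fun y => u (t • y)) = fun y => t • fderiv ℝ u (t • y) := by
    ext1 y; exact fderiv_comp_smul t
  have h2 : fderiv ℝ (fun y => u (t • y)) = fun y => t ^ 2 • fderiv ℝ u y := by
    ext1 y; simp only [hu]; exact congrFun (fderiv_const_smul_field (f := u) (t ^ 2)) y
  have h3 : (fun y => fderiv ℝ u (t • y)) = fun y => t • fderiv ℝ u y := by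
    ext1 y
    have := congrFun (h1.symm.trans h2) y
    exact smul_right_injective _ ht.ne' (this.trans (by simp [sq, mul_smul]))
  have h4 : fderiv ℝ (fun y => fderiv ℝ u (t • y)) x = t • fderiv ℝ (fderiv ℝ u) (t • x) :=
    fderiv_comp_smul t
  have h5 : fderiv ℝ (fun y => t • fderiv ℝ u y) x = t • fderiv ℝ (fderiv ℝ u) x :=
    congrFun (fderiv_const_smul_field (f := fderiv ℝ u) t) x
  rw [h3, h5] at h4
  rw [qf_hess, qf_hess, smul_right_injective _ ht.ne' h4]

theorem deriv_line {u : E n → ℝ} {x : E n} (hu : DifferentiableAt ℝ u x) (y v : E n) (t : ℝ)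
    (hx : y + t • v = x) :
    HasDerivAt (fun t : ℝ => u (y + t • v)) (fderiv ℝ u x v) t := by
  subst hx
  have h1 : HasDerivAt (fun t : ℝ => y + t • v) v t := by
    simpa using ((hasDerivAt_id t).smul_const v).const_add y
  exact hu.hasFDerivAt.comp_hasDerivAt t h1

theorem deriv_deriv_line {u : E n → ℝ} {x : E n} (hu : ContDiffAt ℝ 2 u x) (v : E n) :
    (∀ᶠ t : ℝ in 𝓝 0, HasDerivAt (fun t : ℝ => u (x + t • v)) (fderiv ℝ u (x + t • v) v) t) ∧
    HasDerivAt (fun t : ℝ => fderiv ℝ u (x + t • v) v) (qf (hess u x) v) 0 := by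
  have hc : Tendsto (fun t : ℝ => x + t • v) (𝓝 0) (𝓝 x) := by
    have : Continuous fun t : ℝ => x + t • v := by fun_prop
    simpa using this.tendsto 0
  constructor
  · filter_upwards [hc.eventually (eventually_differentiableAt hu)] with t ht
    exact deriv_line ht x v t rfl
  · have h1 : HasDerivAt (fun t : ℝ => x + t • v) v 0 := by
      simpa using ((hasDerivAt_id (0 : ℝ)).smul_const v).const_add x
    have h2 : HasFDerivAt (fderiv ℝ u) (fderiv ℝ (fderiv ℝ u) x) (x + (0 : ℝ) • v) := by
      simpa using (differentiableAt_fderiv hu).hasFDerivAt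
    have h3 := h2.comp_hasDerivAt (0 : ℝ) h1
    have h4 := h3.clm_apply (hasDerivAt_const (0 : ℝ) v)
    rw [qf_hess]
    simpa using h4

/-- If `u(x + t v) ≤ u(x) + c t²` for small `t > 0` and `u` has derivative `0` at `x` in the
direction `v`, then the second derivative at `x` in this direction is at most `2 c`. -/
theorem qf_hess_le {u : E n → ℝ} {x v : E n} (hu : ContDiffAt ℝ 2 u x) (h0 : fderiv ℝ u x v = 0)
    {c : ℝ} (h : ∀ᶠ t : ℝ in 𝓝[>] 0, u (x + t • v) ≤ u x + c * t ^ 2) :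
    qf (hess u x) v ≤ 2 * c := by
  by_contra! hlt
  obtain ⟨h1, h2⟩ := deriv_deriv_line hu v
  -- With c' strictly between c and half the second derivative, u(x + tv) - c't² has a local minimum
  -- at 0 by the second derivative test, which contradicts the upper bound for small t > 0.
  obtain ⟨c', hc1, hc2⟩ : ∃ c', c < c' ∧ 2 * c' < qf (hess u x) v :=
    ⟨(c + qf (hess u x) v / 2) / 2, by linarith, by linarith⟩
  have hd : ∀ᶠ t : ℝ in 𝓝 0, HasDerivAt (fun t : ℝ => u (x + t • v) - c' * t ^ 2)
      (fderiv ℝ u (x + t • v) v - c' * (2 * t)) t := by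
    filter_upwards [h1] with t ht
    exact ht.fun_sub (by simpa using ((hasDerivAt_id t).fun_pow 2).const_mul c')
  have hd' : deriv (fun t : ℝ => u (x + t • v) - c' * t ^ 2) =ᶠ[𝓝 0]
      fun t => fderiv ℝ u (x + t • v) v - c' * (2 * t) := by
    filter_upwards [hd] with t ht using ht.deriv
  have hdd : HasDerivAt (fun t => fderiv ℝ u (x + t • v) v - c' * (2 * t))
      (qf (hess u x) v - c' * 2) 0 := by
    exact h2.fun_sub (by simpa using ((hasDerivAt_id (0 : ℝ)).const_mul 2).const_mul c')
  have hmin : IsLocalMin (fun t : ℝ => u (x + t • v) - c' * t ^ 2) 0 := by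
    refine isLocalMin_of_deriv_deriv_pos ?_ ?_ hd.self_of_nhds.continuousAt
    · rw [hd'.deriv_eq, hdd.deriv]; linarith
    · rw [hd'.self_of_nhds]; simp [h0]
  have h5 := (hmin.filter_mono (nhdsWithin_le_nhds (s := Ioi 0))).and (h.and self_mem_nhdsWithin)
  obtain ⟨t, ht1, ht2, ht3⟩ := h5.exists
  have ht3 : 0 < t := ht3
  simp only [zero_smul, add_zero] at ht1
  nlinarith [pow_pos ht3 2]

theorem qf_hess_nonpos_of_isLocalMax {u : E n → ℝ} {x : E n} (hu : ContDiffAt ℝ 2 u x)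
    (h : IsLocalMax u x) (v : E n) : qf (hess u x) v ≤ 0 := by
  have hc : Tendsto (fun t : ℝ => x + t • v) (𝓝[>] 0) (𝓝 x) := by
    have : Continuous fun t : ℝ => x + t • v := by fun_prop
    have := this.tendsto 0
    simp only [zero_smul, add_zero] at this
    exact this.mono_left nhdsWithin_le_nhds
  have := qf_hess_le (c := 0) (v := v) hu (by rw [h.fderiv_eq_zero]; rfl)
    ((hc.eventually h).mono fun t ht => by simpa using ht)
  simpa using this

theorem continuousAt_hess {u : E n → ℝ} {x : E n} (hu : ContDiffAt ℝ 2 u x) :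
    ContinuousAt (hess u) x := by
  have h : ContinuousAt (fderiv ℝ (fderiv ℝ u)) x :=
    (((hu.fderiv_right (m := 1) (by norm_num)).fderiv_right (m := 0) (by norm_num))).continuousAt
  have h2 : ContinuousAt (fun y => (ContinuousLinearMap.flip (fderiv ℝ (fderiv ℝ u) y))) x :=
    (ContinuousLinearMap.flipₗᵢ ℝ (E n) (E n) ℝ).continuous.continuousAt.comp h
  refine Topology.IsInducing.subtypeVal.continuousAt_iff.2 ?_
  exact (h.add h2).const_smul (1 / 2 : ℝ)

/-! ### Homogeneous profiles and functions touching them -/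

/-- An odd function, positively homogeneous of degree two and smooth away from the origin. -/
structure Profile (w : E n → ℝ) : Prop where
  smooth : ContDiffOn ℝ ∞ w {0}ᶜ
  hom : ∀ t : ℝ, 0 < t → ∀ x, w (t • x) = t ^ 2 * w x
  odd : ∀ x, w (-x) = -w x
  nontrivial : ∃ x, w x ≠ 0

namespace Profile

variable {w : E n → ℝ}

theorem neg (hw : Profile w) : Profile fun x => -w x :=
  ⟨hw.smooth.neg, fun t ht x => by simp [hw.hom t ht], fun x => by simp [hw.odd],
    hw.nontrivial.imp fun x hx => by simpa using hx⟩

theorem map_zero (hw : Profile w) : w 0 = 0 := by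
  have := hw.odd 0
  simp only [neg_zero] at this
  linarith

theorem contDiffAt (hw : Profile w) {x : E n} (hx : x ≠ 0) : ContDiffAt ℝ ∞ w x :=
  hw.smooth.contDiffAt (isOpen_compl_singleton.mem_nhds hx)

theorem contDiffAt_two (hw : Profile w) {x : E n} (hx : x ≠ 0) : ContDiffAt ℝ 2 w x :=
  (hw.contDiffAt hx).of_le (by norm_cast)

theorem eq_norm_sq_mul (hw : Profile w) {x : E n} (hx : x ≠ 0) :
    w x = ‖x‖ ^ 2 * w (‖x‖⁻¹ • x) := by
  have h := norm_pos_iff.2 hx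
  rw [← hw.hom _ h, smul_smul, mul_inv_cancel₀ h.ne', one_smul]

theorem exists_bound (hw : Profile w) : ∃ C, 0 ≤ C ∧ ∀ x, |w x| ≤ C * ‖x‖ ^ 2 := by
  have hc : ContinuousOn w (sphere 0 1) := fun x hx =>
    (hw.contDiffAt (ne_of_mem_sphere hx one_ne_zero)).continuousAt.continuousWithinAt
  obtain ⟨C, hC⟩ := (isCompact_sphere (0 : E n) 1).exists_bound_of_continuousOn hc
  refine ⟨|C|, abs_nonneg C, fun x => ?_⟩
  rcases eq_or_ne x 0 with rfl | hx
  · simp [hw.map_zero]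
  · rw [hw.eq_norm_sq_mul hx, abs_mul, abs_of_nonneg (by positivity), mul_comm]
    refine mul_le_mul_of_nonneg_right ?_ (by positivity)
    refine (hC _ ?_).trans (le_abs_self C)
    simp [norm_smul, norm_ne_zero_iff.2 hx]

theorem continuous (hw : Profile w) : Continuous w := by
  rw [continuous_iff_continuousAt]
  intro x
  rcases eq_or_ne x 0 with rfl | hx
  · obtain ⟨C, -, hC⟩ := hw.exists_bound
    rw [ContinuousAt, hw.map_zero]
    refine squeeze_zero_norm hC ?_
    have : Continuous fun x : E n => C * ‖x‖ ^ 2 := by fun_prop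
    simpa using this.tendsto 0
  · exact (hw.contDiffAt hx).continuousAt

theorem pos_dim (hw : Profile w) : 0 < n := by
  rcases Nat.eq_zero_or_pos n with rfl | h
  · obtain ⟨x, hx⟩ := hw.nontrivial
    exact absurd (by rw [Subsingleton.elim x 0, hw.map_zero]) hx
  · exact h

theorem exists_neg (hw : Profile w) {r : ℝ} (hr : 0 < r) : ∃ x, ‖x‖ < r ∧ w x < 0 := by
  obtain ⟨z, hz⟩ : ∃ z, w z < 0 := by
    obtain ⟨x, hx⟩ := hw.nontrivial
    rcases lt_or_gt_of_ne hx with h | h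
    · exact ⟨x, h⟩
    · exact ⟨-x, by rw [hw.odd]; linarith⟩
  have hs : 0 < r / (‖z‖ + 1) := by positivity
  refine ⟨(r / (‖z‖ + 1)) • z, ?_, ?_⟩
  · rw [norm_smul, Real.norm_of_nonneg hs.le, div_mul_eq_mul_div, div_lt_iff₀ (by positivity)]
    nlinarith [norm_nonneg z]
  · rw [hw.hom _ hs]
    nlinarith [pow_pos hs 2]

/-- A form whose quadratic form lies below `2 w` lies below some Hessian of `w`. -/
theorem exists_le_hess (hw : Profile w) {A : SymForm n} (hA : ∀ z, qf A z ≤ 2 * w z) :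
    ∃ e, e ≠ 0 ∧ ∀ z, qf A z ≤ qf (hess w e) z := by
  have : Nonempty (Fin n) := ⟨⟨0, hw.pos_dim⟩⟩
  have hne : (sphere (0 : E n) 1).Nonempty := NormedSpace.sphere_nonempty.2 zero_le_one
  have hcA : Continuous fun x => qf A x := (contDiff_qf A (k := 0)).continuous
  obtain ⟨e, he, hmin⟩ := (isCompact_sphere (0 : E n) 1).exists_isMinOn hne
    (f := fun x => 2 * w x - qf A x) ((hw.continuous.const_mul 2).sub hcA).continuousOn
  have he0 : e ≠ 0 := ne_of_mem_sphere he one_ne_zero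
  have hen : ‖e‖ = 1 := by simpa using he
  set t := 2 * w e - qf A e with ht
  have ht0 : 0 ≤ t := by have := hA e; linarith
  -- By homogeneity the quadratic function of ½(A + tI) lies below w everywhere, with equality at e.
  -- The second order condition at e gives A + tI ≤ D²w(e), and t ≥ 0.
  have key : ∀ x, qf ((1 / 2 : ℝ) • (A + t • idForm)) x - w x ≤ 0 := by
    intro x
    simp only [qf_smul, qf_add, qf_idForm]
    rcases eq_or_ne x 0 with rfl | hx
    · have : qf A 0 = 0 := by simp [qf_apply]
      simp [hw.map_zero, this]
    · have h1 : t ≤ 2 * w (‖x‖⁻¹ • x) - qf A (‖x‖⁻¹ • x) := by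
        refine hmin ?_
        simp [norm_smul, norm_ne_zero_iff.2 hx]
      have h2 := hw.eq_norm_sq_mul hx
      have hp := norm_pos_iff.2 hx
      have h3 : qf A x = ‖x‖ ^ 2 * qf A (‖x‖⁻¹ • x) := by
        rw [qf_smul_right]; field_simp
      rw [h2, h3]
      nlinarith [pow_pos hp 2]
  refine ⟨e, he0, fun z => ?_⟩
  have hmax : IsLocalMax (fun x => qf ((1 / 2 : ℝ) • (A + t • idForm)) x - w x) e := by
    refine Eventually.of_forall fun x => (key x).trans (le_of_eq ?_)
    simp only [qf_smul, qf_add, qf_idForm, hen, ht]; ring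
  have h1 := qf_hess_nonpos_of_isLocalMax ((contDiff_qf _).contDiffAt.sub (hw.contDiffAt_two he0))
    hmax z
  rw [hess_sub (contDiff_qf _).contDiffAt (hw.contDiffAt_two he0), hess_qf, smul_smul] at h1
  simp only [qf_sub, qf_smul, qf_add, qf_idForm] at h1
  nlinarith [mul_nonneg ht0 (sq_nonneg ‖z‖)]

/-- A strict `C²` subsolution does not touch `w` from below. -/
theorem not_isLocalMax (hw : Profile w) {F : SymForm n → ℝ} (hF : Elliptic F)
    (hFw : ∀ x ≠ 0, F (hess w x) = 0) {φ : E n → ℝ} {x : E n} (hφ : ContDiffAt ℝ 2 φ x)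
    (hpos : 0 < F (hess φ x)) : ¬ IsLocalMax (fun y => φ y - w y) x := by
  intro hmax
  rcases eq_or_ne x 0 with rfl | hx
  · have hle : ∀ᶠ y in 𝓝 (0 : E n), φ y ≤ φ 0 + w y := by
      filter_upwards [hmax] with y hy
      rw [hw.map_zero] at hy
      linarith
    -- Since w is bounded by C|y|², φ - C|y|² has a local maximum at 0, and the subtracted term has
    -- zero gradient there.
    have hd : fderiv ℝ φ 0 = 0 := by
      obtain ⟨C, -, hC⟩ := hw.exists_bound
      have hlm : IsLocalMax (fun y => φ y - C * ‖y‖ ^ 2) 0 := by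
        filter_upwards [hle] with y hy
        have := (abs_le.1 (hC y)).2
        simp only [norm_zero]
        linarith
      have h1 : HasFDerivAt (fun y : E n => C * ‖y‖ ^ 2) (0 : E n →L[ℝ] ℝ) 0 := by
        have := ((hasStrictFDerivAt_norm_sq (0 : E n)).hasFDerivAt).const_mul C
        simpa using this
      have h2 := hlm.hasFDerivAt_eq_zero
        ((hφ.differentiableAt (by norm_num)).hasFDerivAt.fun_sub h1)
      simpa using h2
    -- Along a ray, φ(tz) ≤ φ(0) + t²w(z), which bounds the second derivative by 2w(z).
    have hq : ∀ z, qf (hess φ 0) z ≤ 2 * w z := by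
      intro z
      refine qf_hess_le hφ (by rw [hd]; rfl) ?_
      have hc : Tendsto (fun t : ℝ => (0 : E n) + t • z) (𝓝[>] 0) (𝓝 0) := by
        have : Continuous fun t : ℝ => (0 : E n) + t • z := by fun_prop
        have := this.tendsto 0
        simp only [zero_smul, add_zero] at this
        exact this.mono_left nhdsWithin_le_nhds
      filter_upwards [hc.eventually hle, self_mem_nhdsWithin] with t ht ht0
      rw [zero_add, hw.hom t ht0] at ht
      rw [zero_add]
      linarith
    obtain ⟨e, he, hle⟩ := hw.exists_le_hess hq
    have := hF.mono hle
    rw [hFw e he] at this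
    linarith
  · have h1 := qf_hess_nonpos_of_isLocalMax (hφ.sub (hw.contDiffAt_two hx)) hmax
    rw [hess_sub hφ (hw.contDiffAt_two hx)] at h1
    have := hF.mono (A := hess φ x) (B := hess w x) fun v => by
      have := h1 v
      simp only [qf_sub] at this
      linarith
    rw [hFw x hx] at this
    linarith

end Profile

/-! ### Viscosity solutions and comparison with test functions -/

/-- Weak comparison: `v ≤ u` on `G` if `v + ε |y|²` does not touch `u` from below in `G`. -/
theorem le_of_forall_not_isLocalMax {G : Set (E n)} (hG : IsOpen G) (hGc : IsCompact (closure G))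
    {v u : E n → ℝ} (hv : ContinuousOn v (closure G)) (hu : ContinuousOn u (closure G))
    (hb : ∀ x ∈ frontier G, v x ≤ u x)
    (hno : ∀ ε : ℝ, 0 < ε → ∀ x ∈ G, ¬ IsLocalMax (fun y => (v y + qf (ε • idForm) y) - u y) x) :
    ∀ x ∈ G, v x ≤ u x := by
  by_contra! hcon
  obtain ⟨x₁, hx₁, hlt⟩ := hcon
  obtain ⟨R, hR⟩ := hGc.isBounded.exists_norm_le
  have hR0 : 0 ≤ R := (norm_nonneg _).trans (hR x₁ (subset_closure hx₁))
  -- The perturbation ε|y|² is smaller on the closure of G than the gap at x₁, so the maximum is not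
  -- on the boundary.
  obtain ⟨ε, hε, hε'⟩ : ∃ ε > 0, ε * R ^ 2 < v x₁ - u x₁ := by
    refine ⟨(v x₁ - u x₁) / (R ^ 2 + 1), div_pos (by linarith) (by positivity), ?_⟩
    rw [div_mul_eq_mul_div, div_lt_iff₀ (by positivity)]
    nlinarith
  have hcont : ContinuousOn (fun y => (v y + qf (ε • idForm) y) - u y) (closure G) :=
    (hv.add (contDiff_qf (k := 0) _).continuous.continuousOn).sub hu
  obtain ⟨x₀, hx₀, hmax⟩ := hGc.exists_isMaxOn ⟨x₁, subset_closure hx₁⟩ hcont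
  have h1 : v x₁ + qf (ε • idForm) x₁ - u x₁ ≤ v x₀ + qf (ε • idForm) x₀ - u x₀ :=
    hmax (subset_closure hx₁)
  simp only [qf_smul, qf_idForm] at h1
  have hxG : x₀ ∈ G := by
    by_contra hxG
    have hf : x₀ ∈ frontier G := by
      rw [hG.frontier_eq]; exact ⟨hx₀, hxG⟩
    have h2 := hb x₀ hf
    have h3 : ‖x₀‖ ^ 2 ≤ R ^ 2 := by
      have := hR x₀ hx₀
      gcongr
    nlinarith [mul_nonneg hε.le (sq_nonneg ‖x₁‖), mul_le_mul_of_nonneg_left h3 hε.le]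
  exact hno ε hε x₀ hxG ((hmax.on_subset subset_closure).isLocalMax (hG.mem_nhds hxG))

/-- One half of the definition of viscosity solutions: `u` lies below `C²` supersolutions. -/
def LiesBelow (F : SymForm n → ℝ) (Ω : Set (E n)) (u : E n → ℝ) : Prop :=
  ∀ v : E n → ℝ, ContDiffOn ℝ 2 v Ω →
      ∀ G : Set (E n), IsOpen G → IsConnected G → IsCompact (closure G) → closure G ⊆ Ω →
        (∀ x ∈ G, F (hess v x) ≤ 0) → (∀ x ∈ frontier G, u x ≤ v x) → ∀ x ∈ G, u x ≤ v x

/-- The passage from (F, u) to (A ↦ -F(-A), -u) exchanges the two halves of the definition, so only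
one half needs an argument. -/
theorem isViscositySolution_iff {F : SymForm n → ℝ} {Ω : Set (E n)} {u : E n → ℝ} :
    IsViscositySolution F Ω u ↔
      ContinuousOn u Ω ∧ LiesBelow (fun A => -F (-A)) Ω (fun x => -u x) ∧ LiesBelow F Ω u := by
  refine and_congr_right fun _ => ⟨fun h => ⟨?_, ?_⟩, fun h v hv G h1 h2 h3 h4 => ⟨?_, ?_⟩⟩
  · intro v hv G h1 h2 h3 h4 h5 h6 x hx
    have := (h (fun x => -v x) hv.neg G h1 h2 h3 h4).1
      (fun x hx => by have := h5 x hx; rw [hess_neg]; linarith)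
      (fun x hx => by have := h6 x hx; linarith) x hx
    linarith
  · intro v hv G h1 h2 h3 h4
    exact (h v hv G h1 h2 h3 h4).2
  · intro h5 h6 x hx
    have := h.1 (fun x => -v x) hv.neg G h1 h2 h3 h4
      (fun x hx => by have := h5 x hx; simp only [hess_neg, neg_neg]; linarith)
      (fun x hx => by have := h6 x hx; linarith) x hx
    linarith
  · exact h.2 v hv G h1 h2 h3 h4

/-- If no strict subsolution touches `u` from below, then `-u` lies below the supersolutions of
the dual equation. -/
theorem liesBelow_neg_of_not_isLocalMax {F : SymForm n → ℝ} (hF : Elliptic F) (hn : 0 < n)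
    {Ω : Set (E n)} (hΩ : IsOpen Ω) {u : E n → ℝ} (hu : ContinuousOn u Ω)
    (hno : ∀ (φ : E n → ℝ) (x : E n), x ∈ Ω → ContDiffAt ℝ 2 φ x → 0 < F (hess φ x) →
      ¬ IsLocalMax (fun y => φ y - u y) x) :
    LiesBelow (fun A => -F (-A)) Ω (fun x => -u x) := by
  intro v hv G h1 _ h3 h4 h5 h6
  have key := le_of_forall_not_isLocalMax (v := fun x => -v x) (u := u) h1 h3
    (hv.continuousOn.mono h4).neg (hu.mono h4) (fun x hx => by have := h6 x hx; linarith) ?_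
  · intro x hx
    have := key x hx
    linarith
  · intro ε hε x hx
    have hxΩ : x ∈ Ω := h4 (subset_closure hx)
    have hvx : ContDiffAt ℝ 2 v x := hv.contDiffAt (hΩ.mem_nhds hxΩ)
    refine hno (fun y => -v y + qf (ε • idForm) y) x hxΩ (hvx.neg.add (contDiff_qf _).contDiffAt) ?_
    rw [hess_add hvx.neg (contDiff_qf _).contDiffAt, hess_neg, hess_qf, smul_smul]
    have := hF.lt_add hn (-hess v x) (s := 2 * ε) (by positivity)
    have := h5 x hx
    linarith

/-- The negative of a profile is a profile for the dual operator, so the absence of touching from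
below settles both halves. -/
theorem Profile.isViscositySolution {w : E n → ℝ} (hw : Profile w) {F : SymForm n → ℝ}
    (hF : Elliptic F) (hFw : ∀ x ≠ 0, F (hess w x) = 0) {Ω : Set (E n)} (hΩ : IsOpen Ω) :
    IsViscositySolution F Ω w := by
  refine isViscositySolution_iff.2 ⟨hw.continuous.continuousOn, ?_, ?_⟩
  · exact liesBelow_neg_of_not_isLocalMax hF hw.pos_dim hΩ hw.continuous.continuousOn
      fun φ x _ hφ hpos => hw.not_isLocalMax hF hFw hφ hpos
  · have := liesBelow_neg_of_not_isLocalMax hF.neg hw.pos_dim hΩ hw.neg.continuous.continuousOn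
      fun φ x _ hφ hpos => hw.neg.not_isLocalMax hF.neg
        (fun x hx => by rw [hess_neg]; simp [hFw x hx]) hφ hpos
    simpa using this

theorem not_isLocalMax_of_classical {F : SymForm n → ℝ} (hF : Elliptic F) {u φ : E n → ℝ} {x : E n}
    (hu : ContDiffAt ℝ 2 u x) (hFu : F (hess u x) ≤ 0) (hφ : ContDiffAt ℝ 2 φ x)
    (hpos : 0 < F (hess φ x)) : ¬ IsLocalMax (fun y => φ y - u y) x := by
  intro hmax
  have h1 := qf_hess_nonpos_of_isLocalMax (hφ.sub hu) hmax
  rw [hess_sub hφ hu] at h1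
  have := hF.mono (A := hess φ x) (B := hess u x) fun v => by
    have := h1 v
    simp only [qf_sub] at this
    linarith
  linarith

theorem isViscositySolution_of_classical {F : SymForm n → ℝ} (hF : Elliptic F) (hn : 0 < n)
    {Ω : Set (E n)} (hΩ : IsOpen Ω) {u : E n → ℝ} (hu : ContDiffOn ℝ 2 u Ω)
    (hFu : ∀ x ∈ Ω, F (hess u x) = 0) : IsViscositySolution F Ω u := by
  have hux : ∀ x ∈ Ω, ContDiffAt ℝ 2 u x := fun x hx => hu.contDiffAt (hΩ.mem_nhds hx)
  refine isViscositySolution_iff.2 ⟨hu.continuousOn, ?_, ?_⟩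
  · exact liesBelow_neg_of_not_isLocalMax hF hn hΩ hu.continuousOn
      fun φ x hx hφ hpos => not_isLocalMax_of_classical hF (hux x hx) (hFu x hx).le hφ hpos
  · have := liesBelow_neg_of_not_isLocalMax hF.neg hn hΩ hu.neg.continuousOn
      fun φ x hx hφ hpos => not_isLocalMax_of_classical hF.neg (hux x hx).neg
        (by change -F (-hess (fun y => -u y) x) ≤ 0; rw [hess_neg]; simp [hFu x hx]) hφ hpos
    simpa using this

/-! ### Uniqueness and absence of classical solutions -/

namespace Profile

variable {w : E n → ℝ}

/-- A function lying below the supersolutions of `F(D²u) = 0` cannot be touched from above by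
`w(· - h) - δ |·|²` at a point other than `h`. -/
theorem touching_eq (hw : Profile w) {F : SymForm n → ℝ} (hF : Elliptic F)
    (hFw : ∀ x ≠ 0, F (hess w x) = 0) {Ω : Set (E n)} (hΩ : IsOpen Ω) {v : E n → ℝ}
    (hv : LiesBelow F Ω v) {δ : ℝ} (hδ : 0 < δ) {h x₀ : E n} (hx₀ : x₀ ∈ Ω)
    (hmax : ∀ x ∈ Ω, v x + δ * ‖x‖ ^ 2 - w (x - h) ≤ v x₀ + δ * ‖x₀‖ ^ 2 - w (x₀ - h)) :
    x₀ = h := by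
  by_contra hne
  have hd : 0 < dist x₀ h := dist_pos.2 hne
  obtain ⟨r₁, hr₁, hball⟩ := nhds_basis_closedBall.mem_iff.1 (hΩ.mem_nhds hx₀)
  set r := min r₁ (dist x₀ h / 4) with hr
  have hr0 : 0 < r := lt_min hr₁ (by positivity)
  have hrd : r ≤ dist x₀ h / 4 := min_le_right _ _
  let b : ContDiffBump h := ⟨dist x₀ h / 4, dist x₀ h / 2, by positivity, by linarith⟩
  have hrb : b.rOut = dist x₀ h / 2 := rfl
  have hsub : closedBall x₀ r ⊆ Ω := (closedBall_subset_closedBall (min_le_left _ _)).trans hball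
  have hclos : closure (ball x₀ r) = closedBall x₀ r := closure_ball x₀ hr0.ne'
  have hfar : ∀ y ∈ closedBall x₀ r, dist x₀ h / 2 < dist y h := by
    intro y hy
    have h1 := dist_triangle x₀ y h
    have h2 : dist x₀ y ≤ r := by rw [dist_comm]; exact hy
    linarith
  have hbz : ∀ y ∈ closedBall x₀ r, b y = 0 := fun y hy =>
    b.zero_of_le_dist (by rw [hrb]; exact (hfar y hy).le)
  -- Test functions must be C² on all of Ω, so the singularity of w(· - h) is cut off near h; the
  -- closed ball of radius r about x₀ lies outside the support of the cutoff.
  let W : E n → ℝ := fun y => (1 - b y) * w (y - h)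
  have hwh : ∀ y, y ≠ h → ContDiffAt ℝ 2 (fun y => w (y - h)) y := fun y hy =>
    (hw.contDiffAt_two (sub_ne_zero.2 hy)).comp y (contDiffAt_id.sub contDiffAt_const)
  have hW : ContDiff ℝ 2 W := by
    rw [contDiff_iff_contDiffAt]
    intro y
    rcases eq_or_ne y h with rfl | hy
    · refine (contDiffAt_const (c := (0 : ℝ))).congr_of_eventuallyEq ?_
      filter_upwards [b.eventuallyEq_one] with z hz
      simp [W, hz]
    · exact (contDiffAt_const.sub b.contDiffAt).mul (hwh y hy)
  set M := v x₀ + δ * ‖x₀‖ ^ 2 - w (x₀ - h) with hM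
  -- On the ball the Hessian is D²w(y - h) - δI, so φ is a supersolution. On the sphere the two
  -- terms δr²/2 cancel and φ ≥ v by maximality, while φ(x₀) = v(x₀) - δr²/2.
  let φ : E n → ℝ := fun y => (W y + (qf (-δ • idForm) y + qf ((δ / 2) • idForm) (y - x₀))) +
    (M - δ / 2 * r ^ 2)
  have hq1 : ContDiff ℝ 2 fun y : E n => qf (-δ • idForm) y := contDiff_qf _
  have hq2 : ContDiff ℝ 2 fun y : E n => qf ((δ / 2) • idForm) (y - x₀) :=
    (contDiff_qf _).comp (contDiff_id.sub contDiff_const)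
  have hφ : ContDiff ℝ 2 φ := (hW.add (hq1.add hq2)).add contDiff_const
  have hval : ∀ y ∈ closedBall x₀ r, φ y =
      w (y - h) - δ * ‖y‖ ^ 2 + δ / 2 * ‖y - x₀‖ ^ 2 + (M - δ / 2 * r ^ 2) := by
    intro y hy
    simp only [φ, W, hbz y hy, qf_smul, qf_idForm]
    ring
  have hball0 : x₀ ∈ ball x₀ r := mem_ball_self hr0
  have key := hv φ hφ.contDiffOn (ball x₀ r) isOpen_ball
    ⟨⟨x₀, hball0⟩, (convex_ball x₀ r).isPreconnected⟩
    (by rw [hclos]; exact isCompact_closedBall _ _) (by rw [hclos]; exact hsub) ?_ ?_ x₀ hball0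
  · rw [hval x₀ (mem_closedBall_self hr0.le)] at key
    simp only [sub_self, norm_zero] at key
    nlinarith [pow_pos hr0 2]
  · intro y hy
    have hyc := ball_subset_closedBall hy
    have hyh : y ≠ h := by
      intro hyh
      have := hfar y hyc
      rw [hyh, dist_self] at this
      linarith
    have hWy : W =ᶠ[𝓝 y] fun y => w (y - h) := by
      filter_upwards [isOpen_ball.mem_nhds hy] with z hz
      simp [W, hbz z (ball_subset_closedBall hz)]
    have hh : hess φ y = hess w (y - h) + (-δ) • idForm := by
      rw [hess_add_const, hess_add hW.contDiffAt (hq1.add hq2).contDiffAt,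
        hess_add hq1.contDiffAt hq2.contDiffAt, hess_congr hWy, hess_comp_sub w,
        hess_comp_sub (fun y => qf ((δ / 2) • idForm) y), hess_qf, hess_qf]
      module
    have h1 := hF.mono (A := hess w (y - h) + (-δ) • idForm) (B := hess w (y - h)) fun v => by
      simp only [qf_add, qf_smul, qf_idForm]
      nlinarith [sq_nonneg ‖v‖]
    rw [hh, ← hFw (y - h) (sub_ne_zero.2 hyh)]
    exact h1
  · intro y hy
    rw [frontier_ball x₀ hr0.ne'] at hy
    have hyc := sphere_subset_closedBall hy
    have h1 := hmax y (hsub hyc)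
    rw [hval y hyc, ← dist_eq_norm, mem_sphere.1 hy]
    linarith

/-- A function lying below the supersolutions of `F(D²u) = 0` is below `w` in the unit ball if it
agrees with `w` on the unit sphere. -/
theorem le_of_liesBelow (hw : Profile w) {F : SymForm n → ℝ} (hF : Elliptic F)
    (hFw : ∀ x ≠ 0, F (hess w x) = 0) {v : E n → ℝ} (hv : LiesBelow F (ball 0 1) v)
    (hvc : ContinuousOn v (closedBall 0 1)) (hb : ∀ x ∈ sphere (0 : E n) 1, v x = w x) :
    ∀ x ∈ ball (0 : E n) 1, v x ≤ w x := by
  by_contra! hcon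
  obtain ⟨x₁, hx₁, hlt⟩ := hcon
  set g := v x₁ - w x₁ with hg
  have hg0 : 0 < g := by linarith
  have huc : UniformContinuousOn w (closedBall 0 2) :=
    (isCompact_closedBall _ _).uniformContinuousOn_of_continuous hw.continuous.continuousOn
  -- With translation errors below g/8, m - w(· - h) is less than 5g/8 on the unit sphere and more
  -- than 7g/8 at x₁, so its maximum is interior.
  obtain ⟨r₀, hr₀, hr⟩ := Metric.uniformContinuousOn_iff.1 huc (g / 8) (by positivity)
  obtain ⟨r, hr0, hrr, hr1⟩ : ∃ r > 0, r ≤ r₀ ∧ r ≤ 1 :=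
    ⟨min r₀ 1, lt_min hr₀ one_pos, min_le_left _ _, min_le_right _ _⟩
  have hclose : ∀ h, ‖h‖ < r → ∀ x ∈ closedBall (0 : E n) 1, |w (x - h) - w x| < g / 8 := by
    intro h hh x hx
    rw [mem_closedBall_zero_iff] at hx
    refine hr (x - h) ?_ x ?_ ?_
    · rw [mem_closedBall_zero_iff]; linarith [norm_sub_le x h]
    · rw [mem_closedBall_zero_iff]; linarith
    · rw [dist_eq_norm]; simpa using hh.trans_le hrr
  let m : E n → ℝ := fun x => v x + g / 2 * ‖x‖ ^ 2
  have hmc : ContinuousOn m (closedBall 0 1) := hvc.add (by fun_prop)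
  have hx₁c : x₁ ∈ closedBall (0 : E n) 1 := ball_subset_closedBall hx₁
  have hmain : ∀ h, ‖h‖ < r → ∀ x ∈ closedBall (0 : E n) 1, m x - m h ≤ w (x - h) := by
    intro h hh
    have hcont : ContinuousOn (fun x => m x - w (x - h)) (closedBall 0 1) :=
      hmc.sub (hw.continuous.comp (continuous_id.sub continuous_const)).continuousOn
    obtain ⟨x₀, hx₀, hmax⟩ := (isCompact_closedBall (0 : E n) 1).exists_isMaxOn ⟨x₁, hx₁c⟩ hcont
    have hmax' : ∀ x ∈ closedBall (0 : E n) 1, m x - w (x - h) ≤ m x₀ - w (x₀ - h) :=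
      fun x hx => hmax hx
    have hball : x₀ ∈ ball (0 : E n) 1 := by
      by_contra hx
      have hs : x₀ ∈ sphere (0 : E n) 1 := by
        rw [mem_sphere]
        exact le_antisymm hx₀ (not_lt.1 hx)
      have h1 := hmax' x₁ hx₁c
      have h2 := abs_lt.1 (hclose h hh x₀ hx₀)
      have h3 := abs_lt.1 (hclose h hh x₁ hx₁c)
      have h4 := hb x₀ hs
      have h5 : ‖x₀‖ = 1 := by simpa using hs
      simp only [m, h5, h4] at h1
      nlinarith [sq_nonneg ‖x₁‖]
    have heq : x₀ = h := hw.touching_eq hF hFw isOpen_ball hv (half_pos hg0) hball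
      fun x hx => hmax' x (ball_subset_closedBall hx)
    intro x hx
    have := hmax' x hx
    rw [heq, sub_self, hw.map_zero] at this
    linarith
  obtain ⟨C, hC0, hC⟩ := hw.exists_bound
  have hsubb : ball (0 : E n) r ⊆ closedBall 0 1 :=
    ball_subset_closedBall.trans (closedBall_subset_closedBall hr1)
  have hder : ∀ h ∈ ball (0 : E n) r, HasFDerivAt m (0 : E n →L[ℝ] ℝ) h := by
    intro h hh
    -- The inequality m(x) - m(h) ≤ w(x - h) holds with x and h exchanged as well, which makes the
    -- bound two-sided and quadratic.
    have hO : (fun x => m x - m h) =O[𝓝 h] fun x => ‖x - h‖ ^ 2 := by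
      refine Asymptotics.IsBigO.of_bound C ?_
      filter_upwards [isOpen_ball.mem_nhds hh] with x hx
      rw [Real.norm_eq_abs, norm_pow, norm_norm, abs_le]
      have h1 := hmain h (by simpa using hh) x (hsubb hx)
      have h2 := hmain x (by simpa using hx) h (hsubb hh)
      have h3 := (abs_le.1 (hC (x - h))).2
      have h4 := (abs_le.1 (hC (h - x))).2
      rw [norm_sub_rev] at h4
      constructor <;> linarith
    have : HasFDerivAt (fun x => m x - m h) (0 : E n →L[ℝ] ℝ) h := hO.hasFDerivAt (by norm_num)
    have h2 := this.add_const (m h)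
    simpa using h2
  have hconst : ∀ h ∈ ball (0 : E n) r, m h = m 0 := fun h hh =>
    (convex_ball (0 : E n) r).is_const_of_fderivWithin_eq_zero (𝕜 := ℝ)
      (fun y hy => (hder y hy).differentiableAt.differentiableWithinAt)
      (fun y hy => by
        rw [fderivWithin_of_isOpen isOpen_ball hy, (hder y hy).fderiv])
      hh (mem_ball_self hr0)
  -- With m constant near 0, the inequality at h = 0 reads 0 ≤ w(z), which fails for some small z.
  obtain ⟨z, hz, hzneg⟩ := hw.exists_neg hr0
  have hzb : z ∈ ball (0 : E n) r := by simpa using hz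
  have h1 := hmain 0 (by simpa using hr0) z (hsubb hzb)
  rw [hconst z hzb, sub_zero, sub_self] at h1
  linarith

/-- `w` is the only viscosity solution of its own Dirichlet problem in the unit ball. -/
theorem eqOn_of_isViscosityDirichletSolution (hw : Profile w) {F : SymForm n → ℝ}
    (hF : Elliptic F) (hFw : ∀ x ≠ 0, F (hess w x) = 0) {v : E n → ℝ}
    (hv : IsViscosityDirichletSolution F (ball 0 1) w v) : EqOn v w (closedBall 0 1) := by
  obtain ⟨hvis, hc, hb⟩ := hv
  rw [closure_ball _ one_ne_zero] at hc
  rw [frontier_ball _ one_ne_zero] at hb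
  obtain ⟨-, h1, h2⟩ := isViscositySolution_iff.1 hvis
  intro x hx
  rcases (mem_closedBall.1 hx).lt_or_eq with hlt | heq
  · have h3 := hw.le_of_liesBelow hF hFw h2 hc hb x hlt
    have h4 := hw.neg.le_of_liesBelow hF.neg (fun x hx => by rw [hess_neg]; simp [hFw x hx]) h1
      hc.neg (fun x hx => by rw [hb x hx]) x hlt
    linarith
  · exact hb x heq

theorem hess_neg_arg (hw : Profile w) {x : E n} (hx : x ≠ 0) : hess w (-x) = -hess w x := by
  apply ext_qf
  intro v
  have h1 := (deriv_deriv_line (hw.contDiffAt_two hx) v)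
  have h2 := (deriv_deriv_line (hw.contDiffAt_two (neg_ne_zero.2 hx)) (-v))
  have h3 : qf (hess w (-x)) (-v) = qf (hess w (-x)) v := by
    simp [qf_apply]
  have h4 : ∀ t : ℝ, w (-x + t • -v) = -w (x + t • v) := fun t => by
    rw [← hw.odd]; congr 1; module
  rw [qf_neg, ← h3]
  have h5 : (fun t : ℝ => fderiv ℝ w (-x + t • -v) (-v)) =ᶠ[𝓝 0]
      fun t : ℝ => -fderiv ℝ w (x + t • v) v := by
    filter_upwards [h1.1, h2.1] with t ht1 ht2
    simp only [h4] at ht2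
    exact ht2.unique ht1.fun_neg
  exact (h2.2.congr_of_eventuallyEq h5.symm).unique h1.2.fun_neg

/-- Approaching 0 along a ray, a Hessian homogeneous of degree zero is constant, so a limit L would
be its value everywhere off 0; oddness gives L = -L. -/
theorem not_tendsto_hess (hw : Profile w) {e : E n} (he : e ≠ 0) (hne : hess w e ≠ 0) :
    ¬ ∃ L : SymForm n, Tendsto (hess w) (𝓝[≠] (0 : E n)) (𝓝 L) := by
  rintro ⟨L, hL⟩
  have key : ∀ x : E n, x ≠ 0 → hess w x = L := by
    intro x hx
    have hc : Tendsto (fun t : ℝ => t • x) (𝓝[>] 0) (𝓝[≠] 0) := by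
      refine tendsto_nhdsWithin_iff.2 ⟨?_, ?_⟩
      · have : Continuous fun t : ℝ => t • x := by fun_prop
        have := this.tendsto 0
        simp only [zero_smul] at this
        exact this.mono_left nhdsWithin_le_nhds
      · filter_upwards [self_mem_nhdsWithin] with t ht
        exact smul_ne_zero (ne_of_gt ht) hx
    refine tendsto_nhds_unique (f := fun t : ℝ => hess w (t • x)) (l := 𝓝[>] (0 : ℝ)) ?_
      (hL.comp hc)
    refine tendsto_const_nhds.congr' ?_
    filter_upwards [self_mem_nhdsWithin] with t ht
    exact (hess_smul_arg ht (hw.hom t ht) x).symm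
  have h1 := hw.hess_neg_arg he
  rw [key e he, key (-e) (neg_ne_zero.2 he)] at h1
  refine hne ((key e he).trans ?_)
  have h2 : (2 : ℝ) • L = 0 := by rw [two_smul]; nth_rewrite 1 [h1]; simp
  simpa using h2

/-- The Dirichlet problem with boundary values `w` has no classical solution. -/
theorem not_isClassicalDirichletSolution (hw : Profile w) {F : SymForm n → ℝ}
    (hF : Elliptic F) (hFw : ∀ x ≠ 0, F (hess w x) = 0) {e : E n} (he : e ≠ 0)
    (hne : hess w e ≠ 0) : ¬ ∃ u, IsClassicalDirichletSolution F (ball 0 1) w u := by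
  rintro ⟨u, hu, huc, hFu, hub⟩
  have heq := hw.eqOn_of_isViscosityDirichletSolution hF hFw
    ⟨isViscositySolution_of_classical hF hw.pos_dim isOpen_ball hu hFu, huc, hub⟩
  refine hw.not_tendsto_hess he hne ⟨hess u 0, ?_⟩
  have h0 : (0 : E n) ∈ ball (0 : E n) 1 := mem_ball_self one_pos
  have h1 : Tendsto (hess u) (𝓝[≠] (0 : E n)) (𝓝 (hess u 0)) :=
    (continuousAt_hess (hu.contDiffAt (isOpen_ball.mem_nhds h0))).tendsto.mono_left
      nhdsWithin_le_nhds
  refine h1.congr' ?_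
  filter_upwards [mem_nhdsWithin_of_mem_nhds (isOpen_ball.mem_nhds h0)] with x hx
  refine hess_congr ?_
  filter_upwards [isOpen_ball.mem_nhds hx] with y hy
  exact heq (ball_subset_closedBall hy)

end Profile

/-! ### Quaternionic coordinates, the cubic form and the Hessian of `w` -/

theorem quat_re (x : E 12) (j : Fin 3) : (quat x j).re = x (finProdFinEquiv (j, (0 : Fin 4))) := rfl
theorem quat_imI (x : E 12) (j : Fin 3) : (quat x j).imI = x (finProdFinEquiv (j, (1 : Fin 4))) :=
  rfl
theorem quat_imJ (x : E 12) (j : Fin 3) : (quat x j).imJ = x (finProdFinEquiv (j, (2 : Fin 4))) :=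
  rfl
theorem quat_imK (x : E 12) (j : Fin 3) : (quat x j).imK = x (finProdFinEquiv (j, (3 : Fin 4))) :=
  rfl

/-- The quaternionic coordinates as continuous linear maps. -/
def quatL (j : Fin 3) : E 12 →L[ℝ] ℍ[ℝ] :=
  LinearMap.toContinuousLinearMap
    { toFun := fun x => quat x j
      map_add' := fun x y => by ext <;> simp [quat_re, quat_imI, quat_imJ, quat_imK]
      map_smul' := fun c x => by ext <;> simp [quat_re, quat_imI, quat_imJ, quat_imK] }

@[simp] theorem quat_add (x y : E 12) (j : Fin 3) : quat (x + y) j = quat x j + quat y j :=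
  map_add (quatL j) x y

@[simp] theorem quat_smul (c : ℝ) (x : E 12) (j : Fin 3) : quat (c • x) j = c • quat x j :=
  map_smul (quatL j) c x

/-- The point of `ℝ¹²` with given quaternionic coordinates. -/
def ofQuat : (Fin 3 → ℍ[ℝ]) →ₗ[ℝ] E 12 where
  toFun q := WithLp.toLp 2 fun i =>
    ![(q (finProdFinEquiv.symm i : Fin 3 × Fin 4).1).re, (q (finProdFinEquiv.symm i : Fin 3 × Fin 4).1).imI,
      (q (finProdFinEquiv.symm i : Fin 3 × Fin 4).1).imJ, (q (finProdFinEquiv.symm i : Fin 3 × Fin 4).1).imK]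
      (finProdFinEquiv.symm i : Fin 3 × Fin 4).2
  map_add' p q := by
    ext i
    generalize h : (finProdFinEquiv.symm i : Fin 3 × Fin 4) = k
    obtain ⟨k1, k2⟩ := k
    fin_cases k2 <;> simp [h]
  map_smul' c q := by
    ext i
    generalize h : (finProdFinEquiv.symm i : Fin 3 × Fin 4) = k
    obtain ⟨k1, k2⟩ := k
    fin_cases k2 <;> simp [h]

@[simp] theorem quat_ofQuat (q : Fin 3 → ℍ[ℝ]) (j : Fin 3) : quat (ofQuat q) j = q j := by
  ext <;> simp only [quat, ofQuat, LinearMap.coe_mk, AddHom.coe_mk, Equiv.symm_apply_apply] <;> rfl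

theorem inner_eq_sum_quat (x y : E 12) :
    inner ℝ x y = ∑ j, inner ℝ (quat x j) (quat y j) := by
  rw [PiLp.inner_apply, ← Equiv.sum_comp (finProdFinEquiv : Fin 3 × Fin 4 ≃ Fin 12),
    Fintype.sum_prod_type]
  refine Finset.sum_congr rfl fun j _ => ?_
  rw [Quaternion.inner_def, Fin.sum_univ_four]
  simp [quat_re, quat_imI, quat_imJ, quat_imK]
  ring

theorem norm_sq_eq_sum_quat (x : E 12) :
    ‖x‖ ^ 2 = ‖quat x 0‖ ^ 2 + ‖quat x 1‖ ^ 2 + ‖quat x 2‖ ^ 2 := by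
  rw [← real_inner_self_eq_norm_sq, inner_eq_sum_quat, Fin.sum_univ_three]
  simp only [real_inner_self_eq_norm_sq]

/-- The cubic form `Re(ω₁ ω₂ ω₃)`. -/
def cub (x : E 12) : ℝ := (quat x 0 * quat x 1 * quat x 2).re

/-- The derivative of `cub` at `v` in the direction `x`; also half the second derivative at `x`
in the direction `v`. -/
def cubB (x v : E 12) : ℝ :=
  (quat v 0 * quat v 1 * quat x 2 + quat v 0 * quat x 1 * quat v 2 +
    quat x 0 * quat v 1 * quat v 2).re

theorem w_eq (x : E 12) : w x = cub x / ‖x‖ := rfl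

theorem cub_add (x v : E 12) : cub (x + v) = cub x + cubB v x + cubB x v + cub v := by
  simp only [cub, cubB, quat_add, mul_add, add_mul, Quaternion.re_add]; ring

theorem cub_smul (c : ℝ) (x : E 12) : cub (c • x) = c ^ 3 * cub x := by
  simp only [cub, quat_smul, smul_mul_assoc, mul_smul_comm, Quaternion.re_smul, smul_eq_mul]; ring

theorem cubB_smul_left (c : ℝ) (x v : E 12) : cubB (c • x) v = c * cubB x v := by
  simp only [cubB, quat_smul, smul_mul_assoc, mul_smul_comm, Quaternion.re_add,
    Quaternion.re_smul, smul_eq_mul]; ring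

theorem cubB_smul_right (c : ℝ) (x v : E 12) : cubB x (c • v) = c ^ 2 * cubB x v := by
  simp only [cubB, quat_smul, smul_mul_assoc, mul_smul_comm, Quaternion.re_add,
    Quaternion.re_smul, smul_eq_mul]; ring

theorem cubB_add_left (x y v : E 12) : cubB (x + y) v = cubB x v + cubB y v := by
  simp only [cubB, quat_add, mul_add, add_mul, Quaternion.re_add]; ring

theorem contDiff_cub {k : ℕ∞ω} : ContDiff ℝ k cub := by
  have h : ContDiff ℝ k fun x : E 12 => quatL 0 x * quatL 1 x * quatL 2 x :=
    ((quatL 0).contDiff.mul (quatL 1).contDiff).mul (quatL 2).contDiff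
  let reL : ℍ[ℝ] →L[ℝ] ℝ := LinearMap.toContinuousLinearMap
    { toFun := fun q => q.re, map_add' := fun _ _ => rfl, map_smul' := fun c q => by simp }
  exact reL.contDiff.comp h

theorem continuous_quat (j : Fin 3) : Continuous fun x => quat x j := (quatL j).continuous

theorem continuous_cubB {X : Type*} [TopologicalSpace X] {f g : X → E 12} (hf : Continuous f)
    (hg : Continuous g) : Continuous fun p => cubB (f p) (g p) := by
  unfold cubB
  have h1 (j) : Continuous fun p => quat (f p) j := (continuous_quat j).comp hf
  have h2 (j) : Continuous fun p => quat (g p) j := (continuous_quat j).comp hg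
  exact Quaternion.continuous_re.comp
    (((((h2 0).mul (h2 1)).mul (h1 2)).add (((h2 0).mul (h1 1)).mul (h2 2))).add
      (((h1 0).mul (h2 1)).mul (h2 2)))

theorem contDiffOn_w : ContDiffOn ℝ ∞ w {0}ᶜ := fun _ hx =>
  (contDiff_cub.contDiffAt.div (contDiffAt_norm ℝ hx) (norm_ne_zero_iff.2 hx)).contDiffWithinAt

/-- The second derivative of `w` at a unit vector in an orthogonal direction. -/
theorem qf_hess_w {x v : E 12} (hx : ‖x‖ = 1) (hv : inner ℝ x v = 0) :
    qf (hess w x) v = 2 * cubB x v - cub x * ‖v‖ ^ 2 := by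
  have hx0 : x ≠ 0 := fun h => by simp [h] at hx
  have hw : ContDiffAt ℝ 2 w x :=
    (contDiffOn_w.contDiffAt (isOpen_compl_singleton.mem_nhds hx0)).of_le (by norm_cast)
  obtain ⟨h1, h2⟩ := deriv_deriv_line hw v
  set s := ‖v‖ ^ 2 with hs
  have hpos : ∀ t : ℝ, 0 < 1 + s * t ^ 2 := fun t => by positivity
  -- Since v is orthogonal to the unit vector x, |x + tv|² = 1 + st². Hence w along the line is the
  -- cubic polynomial p times r.
  let r : ℝ → ℝ := fun t => (Real.sqrt (1 + s * t ^ 2))⁻¹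
  let p : ℝ → ℝ := fun t => cub x + t * cubB v x + t ^ 2 * cubB x v + t ^ 3 * cub v
  let p' : ℝ → ℝ := fun t => cubB v x + 2 * t * cubB x v + 3 * t ^ 2 * cub v
  have hwr : (fun t : ℝ => w (x + t • v)) = fun t => p t * r t := by
    ext t
    have hn : ‖x + t • v‖ = Real.sqrt (1 + s * t ^ 2) := by
      rw [eq_comm, Real.sqrt_eq_iff_mul_self_eq (hpos t).le (norm_nonneg _), ← sq,
        norm_add_sq_real, inner_smul_right, hv, hx, norm_smul, mul_pow, Real.norm_eq_abs, sq_abs, hs]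
      ring
    rw [w_eq, hn, div_eq_mul_inv, cub_add, cub_smul, cubB_smul_left, cubB_smul_right]
  have hr : ∀ t, HasDerivAt r (-(s * t) * r t ^ 3) t := by
    intro t
    have h3 : HasDerivAt (fun t : ℝ => 1 + s * t ^ 2) (s * (2 * t)) t := by
      simpa using (((hasDerivAt_id t).fun_pow 2).const_mul s).const_add 1
    refine ((h3.sqrt (hpos t).ne').fun_inv (Real.sqrt_pos.2 (hpos t)).ne').congr_deriv ?_
    have := (Real.sqrt_pos.2 (hpos t)).ne'
    simp only [r]
    field_simp
  have hp : ∀ t, HasDerivAt p (p' t) t := by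
    intro t
    have h3 := ((((hasDerivAt_id t).mul_const (cubB v x)).const_add (cub x)).fun_add
      (((hasDerivAt_id t).fun_pow 2).mul_const (cubB x v))).fun_add
      (((hasDerivAt_id t).fun_pow 3).mul_const (cub v))
    refine h3.congr_deriv ?_
    simp [p']
  have hp' : HasDerivAt p' (2 * cubB x v) 0 := by
    have h3 := ((((hasDerivAt_id (0 : ℝ)).const_mul 2).mul_const (cubB x v)).const_add
      (cubB v x)).fun_add ((((hasDerivAt_id (0 : ℝ)).fun_pow 2).const_mul 3).mul_const (cub v))
    refine h3.congr_deriv ?_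
    simp
  have hfd : (fun t : ℝ => fderiv ℝ w (x + t • v) v) =ᶠ[𝓝 0]
      fun t => p' t * r t + p t * (-(s * t) * r t ^ 3) := by
    filter_upwards [h1] with t ht
    rw [hwr] at ht
    exact ht.unique ((hp t).fun_mul (hr t))
  have h3 : HasDerivAt (fun t => -(s * t) * r t ^ 3) (-s) 0 := by
    have := (((hasDerivAt_id (0 : ℝ)).const_mul s).fun_neg).fun_mul ((hr 0).fun_pow 3)
    refine this.congr_deriv ?_
    simp [r]
  have h4 := (hp'.fun_mul (hr 0)).fun_add ((hp 0).fun_mul h3)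
  rw [(h2.congr_of_eventuallyEq hfd.symm).unique h4]
  simp [p, p', r]
  ring

/-! ### Positive directions of the cubic form -/

theorem norm_re_le (q : ℍ[ℝ]) : |q.re| ≤ ‖q‖ := by
  have h := Quaternion.normSq_eq_norm_mul_self q
  rw [Quaternion.normSq_def'] at h
  exact abs_le_of_sq_le_sq (by nlinarith [sq_nonneg q.imI, sq_nonneg q.imJ, sq_nonneg q.imK])
    (norm_nonneg q)

theorem mul_self_of_re_eq_zero {q : ℍ[ℝ]} (h : q.re = 0) : q * q = ((-(‖q‖ ^ 2) : ℝ) : ℍ[ℝ]) := by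
  have hs : star q = -q := Quaternion.star_eq_neg.2 h
  have h1 : q * star q = _ := Quaternion.self_mul_star q
  rw [Quaternion.normSq_eq_norm_mul_self, hs, mul_neg] at h1
  rw [sq, Quaternion.coe_neg, ← h1, neg_neg]

/-- Two linear conditions leave a nonzero solution in the four dimensional space ℍ; three conditions
still do, in `exists_ne_zero_of_three_functionals`. -/
theorem exists_ne_zero_of_two_functionals (ℓ₁ ℓ₂ : ℍ[ℝ] →ₗ[ℝ] ℝ) :
    ∃ f : ℍ[ℝ], f ≠ 0 ∧ ℓ₁ f = 0 ∧ ℓ₂ f = 0 := by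
  have h : ((ℓ₁.prod ℓ₂).ker) ≠ ⊥ := LinearMap.ker_ne_bot_of_finrank_lt (by
    rw [Quaternion.finrank_eq_four, Module.finrank_prod]; simp)
  obtain ⟨f, hf, hf0⟩ := Submodule.exists_mem_ne_zero_of_ne_bot h
  rw [LinearMap.mem_ker] at hf
  exact ⟨f, hf0, congrArg Prod.fst hf, congrArg Prod.snd hf⟩

theorem exists_ne_zero_of_three_functionals (ℓ₁ ℓ₂ ℓ₃ : ℍ[ℝ] →ₗ[ℝ] ℝ) :
    ∃ f : ℍ[ℝ], f ≠ 0 ∧ ℓ₁ f = 0 ∧ ℓ₂ f = 0 ∧ ℓ₃ f = 0 := by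
  have h : ((ℓ₁.prod (ℓ₂.prod ℓ₃)).ker) ≠ ⊥ := LinearMap.ker_ne_bot_of_finrank_lt (by
    rw [Quaternion.finrank_eq_four, Module.finrank_prod, Module.finrank_prod]; simp)
  obtain ⟨f, hf, hf0⟩ := Submodule.exists_mem_ne_zero_of_ne_bot h
  rw [LinearMap.mem_ker] at hf
  exact ⟨f, hf0, congrArg Prod.fst hf, congrArg (fun p => p.2.1) hf,
    congrArg (fun p => p.2.2) hf⟩

theorem norm_star_quat (q : ℍ[ℝ]) : ‖star q‖ = ‖q‖ := Quaternion.norm_star q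

theorem self_mul_star_eq (q : ℍ[ℝ]) : q * star q = ((‖q‖ ^ 2 : ℝ) : ℍ[ℝ]) := by
  rw [Quaternion.self_mul_star, Quaternion.normSq_eq_norm_mul_self, sq]

theorem star_mul_self_eq (q : ℍ[ℝ]) : star q * q = ((‖q‖ ^ 2 : ℝ) : ℍ[ℝ]) := by
  rw [Quaternion.star_mul_self, Quaternion.normSq_eq_norm_mul_self, sq]

theorem norm_ofQuat_sq (q : Fin 3 → ℍ[ℝ]) :
    ‖ofQuat q‖ ^ 2 = ‖q 0‖ ^ 2 + ‖q 1‖ ^ 2 + ‖q 2‖ ^ 2 := by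
  rw [norm_sq_eq_sum_quat]; simp

/-- Conjugation as a real linear map. -/
def starQ : ℍ[ℝ] →ₗ[ℝ] ℍ[ℝ] :=
  { toFun := star
    map_add' := star_add
    map_smul' := fun c q => Quaternion.star_smul c q }

theorem exists_orthogonal (V : ℍ[ℝ] →ₗ[ℝ] E 12) (d m : E 12) :
    ∃ f : ℍ[ℝ], f ≠ 0 ∧ inner ℝ d (V f) = 0 ∧ inner ℝ m (V f) = 0 :=
  exists_ne_zero_of_two_functionals ((innerₗ (E 12) d).comp V) ((innerₗ (E 12) m).comp V)

/-- On a four dimensional space the form `2 cubB d` is `‖d₁‖ ‖v‖²`. -/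
theorem exists_cubB_eq_zero (d m : E 12) (hd : quat d 0 ≠ 0) : ∃ v : E 12, v ≠ 0 ∧
    inner ℝ d v = 0 ∧ inner ℝ m v = 0 ∧ 2 * cubB d v = ‖quat d 0‖ * ‖v‖ ^ 2 := by
  set a := quat d 0
  have ha : 0 < ‖a‖ := norm_pos_iff.2 hd
  -- The two nonzero components have equal norm |a||f|, and they are arranged so that d₀v₁v₂
  -- telescopes to the positive real |a|³|f|². The other two indices use the same device.
  let V : ℍ[ℝ] →ₗ[ℝ] E 12 := ofQuat.comp
    (LinearMap.pi ![0, ‖a‖ • starQ, LinearMap.mulRight ℝ (star a)])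
  have hV : ∀ f, V f = ofQuat ![0, ‖a‖ • star f, f * star a] := fun f => by
    simp only [V, LinearMap.comp_apply]
    congr 1; ext1 j; fin_cases j <;> rfl
  obtain ⟨f, hf, h1, h2⟩ := exists_orthogonal V d m
  have hf' : 0 < ‖f‖ := norm_pos_iff.2 hf
  have hn : ‖V f‖ ^ 2 = 2 * ‖a‖ ^ 2 * ‖f‖ ^ 2 := by
    rw [hV, norm_ofQuat_sq]
    simp [norm_smul]; ring
  refine ⟨V f, ?_, h1, h2, ?_⟩
  · intro h
    rw [h] at hn
    simp at hn
    rcases hn with h | h <;> simp_all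
  · have hB : a * (‖a‖ • star f) * (f * star a) = ((‖a‖ ^ 3 * ‖f‖ ^ 2 : ℝ) : ℍ[ℝ]) := by
      have : a * (‖a‖ • star f) * (f * star a) = ‖a‖ • (a * (star f * f) * star a) := by
        simp only [mul_smul_comm, smul_mul_assoc, mul_assoc]
      rw [this, star_mul_self_eq, ← Quaternion.coe_commutes, mul_assoc, self_mul_star_eq]
      rw [← Quaternion.coe_mul, Quaternion.smul_coe]
      congr 1; ring
    rw [hn, hV]
    simp only [cubB, quat_ofQuat, Matrix.cons_val]
    change 2 * (0 * (‖a‖ • star f) * quat d 2 + 0 * quat d 1 * (f * star a) +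
      a * (‖a‖ • star f) * (f * star a)).re = _
    rw [hB]
    simp only [zero_mul, zero_add, add_zero, Quaternion.re_coe]
    ring

theorem exists_cubB_eq_one (d m : E 12) (hd : quat d 1 ≠ 0) : ∃ v : E 12, v ≠ 0 ∧
    inner ℝ d v = 0 ∧ inner ℝ m v = 0 ∧ 2 * cubB d v = ‖quat d 1‖ * ‖v‖ ^ 2 := by
  set a := quat d 1
  have ha : 0 < ‖a‖ := norm_pos_iff.2 hd
  let V : ℍ[ℝ] →ₗ[ℝ] E 12 := ofQuat.comp
    (LinearMap.pi ![‖a‖ • LinearMap.id, 0, (LinearMap.mulLeft ℝ (star a)).comp starQ])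
  have hV : ∀ f, V f = ofQuat ![‖a‖ • f, 0, star a * star f] := fun f => by
    simp only [V, LinearMap.comp_apply]
    congr 1; ext1 j; fin_cases j <;> rfl
  obtain ⟨f, hf, h1, h2⟩ := exists_orthogonal V d m
  have hf' : 0 < ‖f‖ := norm_pos_iff.2 hf
  have hn : ‖V f‖ ^ 2 = 2 * ‖a‖ ^ 2 * ‖f‖ ^ 2 := by
    rw [hV, norm_ofQuat_sq]
    simp [norm_smul]; ring
  refine ⟨V f, ?_, h1, h2, ?_⟩
  · intro h
    rw [h] at hn
    simp at hn
    rcases hn with h | h <;> simp_all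
  · have hB : ‖a‖ • f * a * (star a * star f) = ((‖a‖ ^ 3 * ‖f‖ ^ 2 : ℝ) : ℍ[ℝ]) := by
      have : ‖a‖ • f * a * (star a * star f) = ‖a‖ • (f * (a * star a) * star f) := by
        simp only [smul_mul_assoc, mul_assoc]
      rw [this, self_mul_star_eq, ← Quaternion.coe_commutes, mul_assoc, self_mul_star_eq]
      rw [← Quaternion.coe_mul, Quaternion.smul_coe]
      congr 1; ring
    rw [hn, hV]
    simp only [cubB, quat_ofQuat, Matrix.cons_val]
    change 2 * (‖a‖ • f * 0 * quat d 2 + ‖a‖ • f * a * (star a * star f) +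
      quat d 0 * 0 * (star a * star f)).re = _
    rw [hB]
    simp only [zero_mul, mul_zero, zero_add, add_zero, Quaternion.re_coe]
    ring

theorem exists_cubB_eq_two (d m : E 12) (hd : quat d 2 ≠ 0) : ∃ v : E 12, v ≠ 0 ∧
    inner ℝ d v = 0 ∧ inner ℝ m v = 0 ∧ 2 * cubB d v = ‖quat d 2‖ * ‖v‖ ^ 2 := by
  set a := quat d 2
  have ha : 0 < ‖a‖ := norm_pos_iff.2 hd
  let V : ℍ[ℝ] →ₗ[ℝ] E 12 := ofQuat.comp
    (LinearMap.pi ![‖a‖ • LinearMap.id, (LinearMap.mulRight ℝ (star a)).comp starQ, 0])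
  have hV : ∀ f, V f = ofQuat ![‖a‖ • f, star f * star a, 0] := fun f => by
    simp only [V, LinearMap.comp_apply]
    congr 1; ext1 j; fin_cases j <;> rfl
  obtain ⟨f, hf, h1, h2⟩ := exists_orthogonal V d m
  have hf' : 0 < ‖f‖ := norm_pos_iff.2 hf
  have hn : ‖V f‖ ^ 2 = 2 * ‖a‖ ^ 2 * ‖f‖ ^ 2 := by
    rw [hV, norm_ofQuat_sq]
    simp [norm_smul]; ring
  refine ⟨V f, ?_, h1, h2, ?_⟩
  · intro h
    rw [h] at hn
    simp at hn
    rcases hn with h | h <;> simp_all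
  · have hB : ‖a‖ • f * (star f * star a) * a = ((‖a‖ ^ 3 * ‖f‖ ^ 2 : ℝ) : ℍ[ℝ]) := by
      have : ‖a‖ • f * (star f * star a) * a = ‖a‖ • ((f * star f) * (star a * a)) := by
        simp only [smul_mul_assoc, mul_assoc]
      rw [this, self_mul_star_eq, star_mul_self_eq]
      rw [← Quaternion.coe_mul, Quaternion.smul_coe]
      congr 1; ring
    rw [hn, hV]
    simp only [cubB, quat_ofQuat, Matrix.cons_val]
    change 2 * (‖a‖ • f * (star f * star a) * a + ‖a‖ • f * quat d 1 * 0 +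
      quat d 0 * (star f * star a) * 0).re = _
    rw [hB]
    simp only [mul_zero, add_zero, Quaternion.re_coe]
    ring

/-- The gradient of `cub`. -/
def gradCub (m : E 12) : E 12 :=
  ofQuat ![star (quat m 1 * quat m 2), star (quat m 2 * quat m 0), star (quat m 0 * quat m 1)]

theorem re_mul_comm (p q : ℍ[ℝ]) : (p * q).re = (q * p).re := by
  simp only [Quaternion.re_mul]; ring

theorem inner_gradCub (d m : E 12) : inner ℝ d (gradCub m) = cubB d m := by
  rw [inner_eq_sum_quat, Fin.sum_univ_three]
  simp only [gradCub, quat_ofQuat, Quaternion.inner_def, Matrix.cons_val, star_star, cubB,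
    Quaternion.re_add]
  rw [re_mul_comm (quat d 2), mul_assoc (quat d 0), ← mul_assoc (quat d 1),
    re_mul_comm (quat d 1 * quat m 2), ← mul_assoc (quat m 0)]
  ring

theorem cubB_self (m : E 12) : cubB m m = 3 * cub m := by
  simp only [cubB, cub, Quaternion.re_add]; ring

/-- The squared norm is xy + yz + zx in the squared norms of the components of m, at most (x + y +
z)²/3. -/
theorem norm_gradCub_sq_le {m : E 12} (hm : ‖m‖ = 1) : ‖gradCub m‖ ^ 2 ≤ 1 / 3 := by
  have h := norm_sq_eq_sum_quat m
  rw [gradCub, norm_ofQuat_sq]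
  simp only [Matrix.cons_val, norm_star_quat, norm_mul, mul_pow]
  rw [hm] at h
  set x := ‖quat m 0‖ ^ 2
  set y := ‖quat m 1‖ ^ 2
  set z := ‖quat m 2‖ ^ 2
  nlinarith [sq_nonneg (x - y), sq_nonneg (y - z), sq_nonneg (z - x)]

/-- The case where all components of `d` are bounded by `cubB d m`. -/
theorem exists_of_norm_le {d m : E 12} (hd : ‖d‖ = 1) (hm : ‖m‖ = 1) (hdm : inner ℝ d m = 0)
    (h : ∀ j, ‖quat d j‖ ≤ cubB d m) : ∃ v : E 12, v ≠ 0 ∧ inner ℝ d v = 0 ∧ inner ℝ m v = 0 ∧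
      cubB d m * ‖v‖ ^ 2 < 2 * cubB d v ∧ cub d * ‖v‖ ^ 2 < 2 * cubB d v := by
  set δ := cubB d m with hδ
  have hδ0 : 0 ≤ δ := (norm_nonneg _).trans (h 0)
  have hd2 := norm_sq_eq_sum_quat d
  rw [hd] at hd2
  have hg := norm_gradCub_sq_le hm
  have hin : inner ℝ d (gradCub m) = δ := inner_gradCub d m
  have hle (j) : ‖quat d j‖ ^ 2 ≤ δ ^ 2 := pow_le_pow_left₀ (norm_nonneg _) (h j) 2
  have h0 := hle 0
  have h1 := hle 1
  have h2 := hle 2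
  have hsub : ‖gradCub m - δ • d‖ ^ 2 = ‖gradCub m‖ ^ 2 - δ ^ 2 := by
    rw [norm_sub_sq_real, inner_smul_right, real_inner_comm, hin, norm_smul, mul_pow, hd,
      Real.norm_eq_abs, sq_abs]
    ring
  -- The hypothesis gives 1 = |d|² ≤ 3δ², while δ = ⟨d, grad P(m)⟩ with |grad P(m)|² ≤ 1/3. Equality
  -- throughout fixes the norms of the components of d and makes the gradient equal to δd.
  have hδ2 : δ ^ 2 = 1 / 3 := by nlinarith [sq_nonneg ‖gradCub m - δ • d‖]
  have hδp : 0 < δ := by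
    rcases hδ0.eq_or_lt with h | h
    · rw [← h] at hδ2; norm_num at hδ2
    · exact h
  have hgrad : gradCub m = δ • d := by
    have : ‖gradCub m - δ • d‖ ^ 2 = 0 := le_antisymm (by linarith) (sq_nonneg _)
    exact sub_eq_zero.1 (norm_eq_zero.1 (pow_eq_zero_iff (two_ne_zero) |>.1 this))
  have hn0 : ‖quat d 0‖ ^ 2 = δ ^ 2 := by linarith
  have hn1 : ‖quat d 1‖ ^ 2 = δ ^ 2 := by linarith
  have hn2 : ‖quat d 2‖ ^ 2 = δ ^ 2 := by linarith
  have hm0 : cub m = 0 := by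
    have h3 := inner_gradCub m m
    rw [hgrad, inner_smul_right, real_inner_comm, hdm, cubB_self] at h3
    linarith
  set a := quat d 0
  set b := quat d 1
  set c := quat d 2
  have habs : ∀ q : ℍ[ℝ], ‖q‖ ^ 2 = δ ^ 2 → ‖q‖ = δ := fun q hq => by
    rwa [pow_left_inj₀ (norm_nonneg q) hδ0 two_ne_zero] at hq
  -- the product of the components of `d` is a negative real number
  have habc : a * b * c = ((-δ ^ 3 : ℝ) : ℍ[ℝ]) := by
    have e0 : star (quat m 1 * quat m 2) = δ • a := by
      have := congrArg (fun x => quat x 0) hgrad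
      simpa [gradCub] using this
    have e1 : star (quat m 2 * quat m 0) = δ • b := by
      have := congrArg (fun x => quat x 1) hgrad
      simpa [gradCub] using this
    have e2 : star (quat m 0 * quat m 1) = δ • c := by
      have := congrArg (fun x => quat x 2) hgrad
      simpa [gradCub] using this
    -- The product of the three conjugates regroups as the square of the conjugate of m₀m₁m₂, which
    -- is purely imaginary because P(m) = 0.
    have e3 : (δ • a) * (δ • b) * (δ • c) =
        ((-(‖quat m 0 * quat m 1 * quat m 2‖ ^ 2) : ℝ) : ℍ[ℝ]) := by
      rw [← e0, ← e1, ← e2, ← Quaternion.star_coe, ← mul_self_of_re_eq_zero hm0]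
      simp only [star_mul, mul_assoc]
    have e4 : (δ • a) * (δ • b) * (δ • c) = δ ^ 3 • (a * b * c) := by
      simp only [smul_mul_assoc, mul_smul_comm, smul_smul]
      congr 1; ring
    have e5 : ‖(δ • a) * (δ • b) * (δ • c)‖ = δ ^ 6 := by
      simp only [norm_mul, norm_smul, habs a hn0, habs b hn1, habs c hn2, Real.norm_of_nonneg hδ0]
      ring
    rw [e3, Quaternion.norm_coe, Real.norm_eq_abs, abs_neg, abs_of_nonneg (by positivity)] at e5
    rw [e5, e4] at e3
    have hδ3 : δ ^ 3 ≠ 0 := by positivity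
    apply smul_right_injective _ hδ3
    simp only
    rw [e3, Quaternion.smul_coe]
    congr 1; ring
  have hb : star a * star c = -(δ • b) := by
    have e1 : star a * (a * b * c) * star c = ((δ ^ 4 : ℝ) : ℍ[ℝ]) * b := by
      have : star a * (a * b * c) * star c = (star a * a) * b * (c * star c) := by
        simp only [mul_assoc]
      rw [this, star_mul_self_eq, self_mul_star_eq, hn0, hn2, ← Quaternion.coe_commutes,
        ← mul_assoc, ← Quaternion.coe_mul]
      congr 2; ring
    rw [habc, ← Quaternion.coe_commutes, mul_assoc, Quaternion.coe_mul_eq_smul,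
      Quaternion.coe_mul_eq_smul] at e1
    have hδ3 : -δ ^ 3 ≠ 0 := by
      have : 0 < δ ^ 3 := by positivity
      linarith
    apply smul_right_injective _ hδ3
    simp only
    rw [e1, smul_neg, smul_smul, ← neg_smul]
    congr 1; ring
  -- On this space two of the three terms of B(d, V f) telescope to δ³|f|². The middle one equals -δ
  -- Re((fb)²), which has the same value once Re(fb) = 0; that is the third linear condition imposed
  -- on f. In total 2B(d,v) = 6δ³|f|² = 2δ|v|², while P(d) = -δ³ < 0.
  let V : ℍ[ℝ] →ₗ[ℝ] E 12 := ofQuat.comp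
    (LinearMap.pi ![LinearMap.mulLeft ℝ (star c), δ • starQ, LinearMap.mulRight ℝ (star a)])
  have hV : ∀ f, V f = ofQuat ![star c * f, δ • star f, f * star a] := fun f => by
    simp only [V, LinearMap.comp_apply]
    congr 1; ext1 j; fin_cases j <;> rfl
  let reL : ℍ[ℝ] →ₗ[ℝ] ℝ :=
    { toFun := fun q => q.re, map_add' := fun _ _ => rfl, map_smul' := fun c q => by simp }
  obtain ⟨f, hf, h1, h2, h3⟩ := exists_ne_zero_of_three_functionals
    ((innerₗ (E 12) d).comp V) ((innerₗ (E 12) m).comp V) (reL.comp (LinearMap.mulRight ℝ b))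
  have h3 : (f * b).re = 0 := h3
  have hf' : 0 < ‖f‖ := norm_pos_iff.2 hf
  have hn : ‖V f‖ ^ 2 = ‖f‖ ^ 2 := by
    rw [hV, norm_ofQuat_sq]
    simp only [Matrix.cons_val, norm_mul, norm_star_quat, norm_smul, mul_pow, hn0, hn2,
      Real.norm_eq_abs, sq_abs, hδ2]
    ring
  have hB : cubB d (V f) = 3 * δ ^ 3 * ‖f‖ ^ 2 := by
    have t1 : star c * f * (δ • star f) * c = ((δ ^ 3 * ‖f‖ ^ 2 : ℝ) : ℍ[ℝ]) := by
      have : star c * f * (δ • star f) * c = δ • (star c * (f * star f) * c) := by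
        simp only [mul_smul_comm, smul_mul_assoc, mul_assoc]
      rw [this, self_mul_star_eq, ← Quaternion.coe_commutes, mul_assoc, star_mul_self_eq, hn2]
      rw [← Quaternion.coe_mul, Quaternion.smul_coe]
      congr 1; ring
    have t3 : a * (δ • star f) * (f * star a) = ((δ ^ 3 * ‖f‖ ^ 2 : ℝ) : ℍ[ℝ]) := by
      have : a * (δ • star f) * (f * star a) = δ • (a * (star f * f) * star a) := by
        simp only [mul_smul_comm, smul_mul_assoc, mul_assoc]
      rw [this, star_mul_self_eq, ← Quaternion.coe_commutes, mul_assoc, self_mul_star_eq, hn0]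
      rw [← Quaternion.coe_mul, Quaternion.smul_coe]
      congr 1; ring
    have t2 : (star c * f * b * (f * star a)).re = δ ^ 3 * ‖f‖ ^ 2 := by
      have : (star c * f * b * (f * star a)).re = (f * b * f * (star a * star c)).re := by
        rw [mul_assoc (star c), mul_assoc (star c), re_mul_comm]
        simp only [mul_assoc]
      rw [this, hb, mul_neg, mul_smul_comm, mul_assoc (f * b), mul_self_of_re_eq_zero h3, norm_mul,
        mul_pow, hn1]
      simp only [Quaternion.re_neg, Quaternion.re_smul, Quaternion.re_coe, smul_eq_mul]
      ring
    rw [hV]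
    simp only [cubB, quat_ofQuat, Matrix.cons_val]
    change (star c * f * (δ • star f) * c + star c * f * b * (f * star a) +
      a * (δ • star f) * (f * star a)).re = _
    rw [t1, t3, Quaternion.re_add, Quaternion.re_add, t2, Quaternion.re_coe]
    ring
  have hcub : cub d = -δ ^ 3 := by
    change (a * b * c).re = _
    rw [habc, Quaternion.re_coe]
  have hd3 : δ ^ 3 = δ / 3 := by
    calc δ ^ 3 = δ * δ ^ 2 := by ring
      _ = _ := by rw [hδ2]; ring
  have hpos : 0 < δ * ‖f‖ ^ 2 := by positivity
  refine ⟨V f, ?_, h1, h2, ?_, ?_⟩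
  · intro h
    rw [h] at hn
    simp at hn
    exact hf (by simpa using hn.symm)
  · rw [hB, hn, hd3]
    linarith
  · rw [hB, hn, hcub, hd3]
    linarith

theorem abs_cub_le (d : E 12) : |cub d| ≤ ‖quat d 0‖ * ‖quat d 1‖ * ‖quat d 2‖ := by
  rw [← norm_mul, ← norm_mul]; exact norm_re_le _

/-- Let |d_j| be the largest component norm. If it exceeds B(d,m), a v with 2B(d,v) = |d_j||v|²
works, because P(d) is at most half of |d_j|. Otherwise all component norms are at most B(d,m),
which is the equality case. -/
theorem exists_cubB_lt {d m : E 12} (hd : ‖d‖ = 1) (hm : ‖m‖ = 1) (hdm : inner ℝ d m = 0) :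
    ∃ v : E 12, v ≠ 0 ∧ inner ℝ d v = 0 ∧ inner ℝ m v = 0 ∧
      cubB d m * ‖v‖ ^ 2 < 2 * cubB d v ∧ cub d * ‖v‖ ^ 2 < 2 * cubB d v := by
  have hd2 := norm_sq_eq_sum_quat d
  rw [hd] at hd2
  obtain ⟨j, hj⟩ := Finite.exists_max fun j => ‖quat d j‖
  by_cases hδ : ‖quat d j‖ ≤ cubB d m
  · exact exists_of_norm_le hd hm hdm fun i => (hj i).trans hδ
  push Not at hδ
  have hj0 := hj 0
  have hj1 := hj 1
  have hj2 := hj 2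
  have h0 := norm_nonneg (quat d 0)
  have h1 := norm_nonneg (quat d 1)
  have h2 := norm_nonneg (quat d 2)
  have hpos : 0 < ‖quat d j‖ := by
    by_contra! hle
    have : ‖quat d 0‖ = 0 := by linarith
    have : ‖quat d 1‖ = 0 := by linarith
    have : ‖quat d 2‖ = 0 := by linarith
    simp_all
  have hcub : cub d < ‖quat d j‖ := by
    have h3 := (abs_le.1 (abs_cub_le d)).2
    have h4 : ‖quat d 1‖ * ‖quat d 2‖ ≤ 1 / 2 := by
      nlinarith [sq_nonneg (‖quat d 1‖ - ‖quat d 2‖), sq_nonneg ‖quat d 0‖]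
    nlinarith
  have hne : quat d j ≠ 0 := norm_pos_iff.1 hpos
  have key : ∃ v : E 12, v ≠ 0 ∧ inner ℝ d v = 0 ∧ inner ℝ m v = 0 ∧
      2 * cubB d v = ‖quat d j‖ * ‖v‖ ^ 2 := by
    fin_cases j
    · exact exists_cubB_eq_zero d m hne
    · exact exists_cubB_eq_one d m hne
    · exact exists_cubB_eq_two d m hne
  obtain ⟨v, hv, hv1, hv2, hv3⟩ := key
  have hvp : 0 < ‖v‖ ^ 2 := by have := norm_pos_iff.2 hv; positivity
  exact ⟨v, hv, hv1, hv2, by rw [hv3]; exact mul_lt_mul_of_pos_right hδ hvp,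
    by rw [hv3]; exact mul_lt_mul_of_pos_right hcub hvp⟩

/-- Both inequalities are strict and the orthonormal pairs lie in a compact set, so the slack can be
chosen uniformly. -/
theorem exists_uniform_cubB_lt : ∃ c : ℝ, 0 < c ∧ ∀ d m : E 12, ‖d‖ = 1 → ‖m‖ = 1 →
    inner ℝ d m = 0 → ∃ v : E 12, v ≠ 0 ∧ inner ℝ d v = 0 ∧ inner ℝ m v = 0 ∧
      (cubB d m + c) * ‖v‖ ^ 2 < 2 * cubB d v ∧ (cub d + c) * ‖v‖ ^ 2 < 2 * cubB d v := by
  let Q : ℝ → E 12 × E 12 → Prop := fun c p => ‖p.1‖ = 1 → ‖p.2‖ = 1 →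
    inner ℝ p.1 p.2 = 0 → ∃ v : E 12, v ≠ 0 ∧ inner ℝ p.1 v = 0 ∧ inner ℝ p.2 v = 0 ∧
      (cubB p.1 p.2 + c) * ‖v‖ ^ 2 < 2 * cubB p.1 v ∧ (cub p.1 + c) * ‖v‖ ^ 2 < 2 * cubB p.1 v
  have hQ : ∀ c c' p, c' ≤ c → Q c p → Q c' p := by
    intro c c' p hc h h1 h2 h3
    obtain ⟨v, hv, hv1, hv2, hv3, hv4⟩ := h h1 h2 h3
    exact ⟨v, hv, hv1, hv2, lt_of_le_of_lt (by gcongr) hv3, lt_of_le_of_lt (by gcongr) hv4⟩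
  have hK : IsCompact (sphere (0 : E 12) 1 ×ˢ sphere (0 : E 12) 1) :=
    (isCompact_sphere _ _).prod (isCompact_sphere _ _)
  have key := hK.induction_on (p := fun S => ∃ c : ℝ, 0 < c ∧ ∀ p ∈ S, Q c p)
    ⟨1, one_pos, by simp⟩ (fun S T hST ⟨c, hc, h⟩ => ⟨c, hc, fun p hp => h p (hST hp)⟩)
    (fun S T ⟨c, hc, h⟩ ⟨c', hc', h'⟩ => ⟨min c c', lt_min hc hc', fun p hp => hp.elim
      (fun hp => hQ _ _ p (min_le_left _ _) (h p hp))
      (fun hp => hQ _ _ p (min_le_right _ _) (h' p hp))⟩) ?_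
  · obtain ⟨c, hc, h⟩ := key
    exact ⟨c, hc, fun d m hd hm hdm => h (d, m) (by simp [hd, hm]) hd hm hdm⟩
  rintro ⟨d₀, m₀⟩ hp
  have hd₀ : ‖d₀‖ = 1 := by simpa using hp.1
  have hm₀ : ‖m₀‖ = 1 := by simpa using hp.2
  by_cases horth : inner ℝ d₀ m₀ = 0
  · obtain ⟨v₀, hv, hv1, hv2, hv3, hv4⟩ := exists_cubB_lt hd₀ hm₀ horth
    have hvp : 0 < ‖v₀‖ ^ 2 := by have := norm_pos_iff.2 hv; positivity
    obtain ⟨c, hc, hc1, hc2⟩ : ∃ c : ℝ, 0 < c ∧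
        (cubB d₀ m₀ + c) * ‖v₀‖ ^ 2 < 2 * cubB d₀ v₀ ∧
        (cub d₀ + c) * ‖v₀‖ ^ 2 < 2 * cubB d₀ v₀ := by
      have e1 : Tendsto (fun c : ℝ => (cubB d₀ m₀ + c) * ‖v₀‖ ^ 2) (𝓝[>] 0)
          (𝓝 ((cubB d₀ m₀ + 0) * ‖v₀‖ ^ 2)) :=
        ((Continuous.tendsto (by fun_prop) 0)).mono_left nhdsWithin_le_nhds
      have e2 : Tendsto (fun c : ℝ => (cub d₀ + c) * ‖v₀‖ ^ 2) (𝓝[>] 0)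
          (𝓝 ((cub d₀ + 0) * ‖v₀‖ ^ 2)) :=
        ((Continuous.tendsto (by fun_prop) 0)).mono_left nhdsWithin_le_nhds
      have := (e1.eventually_lt_const (by simpa using hv3)).and
        ((e2.eventually_lt_const (by simpa using hv4)).and self_mem_nhdsWithin)
      obtain ⟨c, h1, h2, h3⟩ := this.exists
      exact ⟨c, h3, h1, h2⟩
    -- Projecting v₀ off d and m restores exact orthogonality at nearby orthonormal pairs and
    -- depends continuously on the pair.
    let V : E 12 × E 12 → E 12 := fun p => v₀ - inner ℝ p.1 v₀ • p.1 - inner ℝ p.2 v₀ • p.2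
    have hVc : Continuous V := by fun_prop
    have hV0 : V (d₀, m₀) = v₀ := by simp [V, hv1, hv2]
    have hVo : ∀ d m : E 12, ‖d‖ = 1 → ‖m‖ = 1 → inner ℝ d m = 0 →
        inner ℝ d (V (d, m)) = 0 ∧ inner ℝ m (V (d, m)) = 0 := by
      intro d m hd hm hdm
      have hd' : inner ℝ d d = (1 : ℝ) := by rw [real_inner_self_eq_norm_sq, hd]; norm_num
      have hm' : inner ℝ m m = (1 : ℝ) := by rw [real_inner_self_eq_norm_sq, hm]; norm_num
      have hmd : inner ℝ m d = (0 : ℝ) := by rw [real_inner_comm]; exact hdm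
      constructor
      · simp only [V, inner_sub_right, inner_smul_right, hd', hdm]; ring
      · simp only [V, inner_sub_right, inner_smul_right, hm', hmd]; ring
    clear_value V
    have hB0 : Continuous fun p : E 12 × E 12 => cubB p.1 p.2 :=
      continuous_cubB continuous_fst continuous_snd
    have hB1 : Continuous fun p : E 12 × E 12 => cubB p.1 (V p) :=
      continuous_cubB continuous_fst hVc
    have hcub : Continuous fun p : E 12 × E 12 => cub p.1 :=
      (contDiff_cub (k := 0)).continuous.comp continuous_fst
    have f1 : ∀ᶠ p in 𝓝 (d₀, m₀), (cubB p.1 p.2 + c) * ‖V p‖ ^ 2 < 2 * cubB p.1 (V p) := by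
      have g1 : Continuous fun p : E 12 × E 12 => (cubB p.1 p.2 + c) * ‖V p‖ ^ 2 := by fun_prop
      have g2 : Continuous fun p : E 12 × E 12 => 2 * cubB p.1 (V p) := by fun_prop
      exact g1.continuousAt.eventually_lt g2.continuousAt (by rw [hV0]; exact hc1)
    have f2 : ∀ᶠ p in 𝓝 (d₀, m₀), (cub p.1 + c) * ‖V p‖ ^ 2 < 2 * cubB p.1 (V p) := by
      have g1 : Continuous fun p : E 12 × E 12 => (cub p.1 + c) * ‖V p‖ ^ 2 := by fun_prop
      have g2 : Continuous fun p : E 12 × E 12 => 2 * cubB p.1 (V p) := by fun_prop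
      exact g1.continuousAt.eventually_lt g2.continuousAt (by rw [hV0]; exact hc2)
    have f3 : ∀ᶠ p in 𝓝 (d₀, m₀), V p ≠ 0 :=
      hVc.continuousAt.eventually_ne (by rw [hV0]; exact hv)
    refine ⟨_, mem_nhdsWithin_of_mem_nhds (f1.and (f2.and f3)), c, hc, ?_⟩
    rintro ⟨d, m⟩ ⟨g1, g2, g3⟩ hd hm hdm
    exact ⟨V (d, m), g3, (hVo d m hd hm hdm).1, (hVo d m hd hm hdm).2, g1, g2⟩
  · have : ∀ᶠ p : E 12 × E 12 in 𝓝 (d₀, m₀), inner ℝ p.1 p.2 ≠ 0 :=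
      (continuous_fst.inner continuous_snd).continuousAt.eventually_ne horth
    exact ⟨_, mem_nhdsWithin_of_mem_nhds this, 1, one_pos, fun p hp _ _ h => absurd h hp⟩

/-- Supplies m for antipodal points, whose midpoint is zero and determines no direction. -/
theorem exists_unit_orthogonal (d : E 12) : ∃ m : E 12, ‖m‖ = 1 ∧ inner ℝ d m = 0 := by
  let V : ℍ[ℝ] →ₗ[ℝ] E 12 := ofQuat.comp (LinearMap.single ℝ (fun _ : Fin 3 => ℍ[ℝ]) 0)
  obtain ⟨f, hf, h1, -⟩ := exists_orthogonal V d d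
  have hne : V f ≠ 0 := by
    intro h
    have h2 := congrArg (fun x => quatL 0 x) h
    simp [V] at h2
    exact hf h2
  refine ⟨‖V f‖⁻¹ • V f, ?_, ?_⟩
  · rw [norm_smul, norm_inv, norm_norm, inv_mul_cancel₀ (norm_ne_zero_iff.2 hne)]
  · rw [inner_smul_right, h1, mul_zero]

/-- Decomposition of two unit vectors along their difference and an orthogonal unit vector. -/
theorem exists_decomposition {x y : E 12} (hx : ‖x‖ = 1) (hy : ‖y‖ = 1) (hxy : x ≠ y) :
    ∃ (d m : E 12) (s ρ : ℝ), 0 < s ∧ s = ‖x - y‖ ∧ ‖d‖ = 1 ∧ ‖m‖ = 1 ∧ inner ℝ d m = 0 ∧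
      x = ρ • m + (s / 2) • d ∧ y = ρ • m + (-s / 2) • d ∧ ρ ^ 2 + s ^ 2 / 4 = 1 := by
  set s := ‖x - y‖ with hs
  have hs0 : 0 < s := norm_pos_iff.2 (sub_ne_zero.2 hxy)
  set d := s⁻¹ • (x - y) with hd
  have hsd : s • d = x - y := by rw [hd, smul_smul, mul_inv_cancel₀ hs0.ne', one_smul]
  have hd1 : ‖d‖ = 1 := by rw [hd, norm_smul, norm_inv, hs, norm_norm, inv_mul_cancel₀ hs0.ne']
  set M := (1 / 2 : ℝ) • (x + y) with hM
  have hdM : inner ℝ d M = 0 := by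
    rw [hd, hM, inner_smul_left, inner_smul_right, inner_sub_left, inner_add_right, inner_add_right,
      real_inner_self_eq_norm_sq, real_inner_self_eq_norm_sq, hx, hy, real_inner_comm]
    ring
  clear_value d
  have hxM : x = M + (s / 2) • d := by
    have : (s / 2) • d = (1 / 2 : ℝ) • (x - y) := by rw [← hsd, smul_smul]; congr 1; ring
    rw [this, hM]; module
  have hyM : y = M + (-s / 2) • d := by
    have : (-s / 2) • d = (-1 / 2 : ℝ) • (x - y) := by rw [← hsd, smul_smul]; congr 1; ring
    rw [this, hM]; module
  clear_value M
  obtain ⟨m, hm, hdm, hMm⟩ : ∃ m : E 12, ‖m‖ = 1 ∧ inner ℝ d m = 0 ∧ M = ‖M‖ • m := by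
    rcases eq_or_ne M 0 with h0 | h0
    · obtain ⟨m, hm, hdm⟩ := exists_unit_orthogonal d
      exact ⟨m, hm, hdm, by simp [h0]⟩
    · have hn := norm_ne_zero_iff.2 h0
      exact ⟨‖M‖⁻¹ • M, by rw [norm_smul, norm_inv, norm_norm, inv_mul_cancel₀ hn],
        by rw [inner_smul_right, hdM, mul_zero], by rw [smul_smul, mul_inv_cancel₀ hn, one_smul]⟩
  refine ⟨d, m, s, ‖M‖, hs0, rfl, hd1, hm, hdm, by rw [← hMm]; exact hxM,
    by rw [← hMm]; exact hyM, ?_⟩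
  have h1 : ‖x‖ ^ 2 = ‖M‖ ^ 2 + s ^ 2 / 4 := by
    rw [hxM, norm_add_sq_real, inner_smul_right, real_inner_comm, hdM, norm_smul, hd1,
      Real.norm_of_nonneg (by positivity)]
    ring
  rw [← h1, hx]; norm_num

/-- The difference of the Hessians of `w` at two unit vectors has a quantitatively positive
direction. -/
theorem hess_w_hyperbolic : ∃ c : ℝ, 0 < c ∧ ∀ x y : E 12, ‖x‖ = 1 → ‖y‖ = 1 →
    ∃ v : E 12, ‖v‖ = 1 ∧ c * ‖x - y‖ ≤ qf (hess w x) v - qf (hess w y) v := by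
  obtain ⟨c, hc, hcv⟩ := exists_uniform_cubB_lt
  refine ⟨c, hc, fun x y hx hy => ?_⟩
  rcases eq_or_ne x y with rfl | hxy
  · exact ⟨x, hx, by simp⟩
  obtain ⟨d, m, s, ρ, hs, hs', hd, hm, hdm, hxd, hyd, hρ⟩ := exists_decomposition hx hy hxy
  obtain ⟨v, hv, hv1, hv2, hv3, hv4⟩ := hcv d m hd hm hdm
  have hvp : 0 < ‖v‖ := norm_pos_iff.2 hv
  have hxv : inner ℝ x v = 0 := by
    rw [hxd, inner_add_left, inner_smul_left, inner_smul_left, hv1, hv2]; simp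
  have hyv : inner ℝ y v = 0 := by
    rw [hyd, inner_add_left, inner_smul_left, inner_smul_left, hv1, hv2]; simp
  have hmain : c * ‖x - y‖ * ‖v‖ ^ 2 ≤ qf (hess w x) v - qf (hess w y) v := by
    rw [qf_hess_w hx hxv, qf_hess_w hy hyv, ← hs']
    have e1 : cubB x v - cubB y v = s * cubB d v := by
      rw [hxd, hyd]
      simp only [cubB_add_left, cubB_smul_left]
      ring
    have e2 : cub x - cub y = s * (ρ ^ 2 * cubB d m + s ^ 2 / 4 * cub d) := by
      rw [hxd, hyd]
      simp only [cub_add, cub_smul, cubB_smul_left, cubB_smul_right]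
      ring
    have e3 : 2 * cubB x v - cub x * ‖v‖ ^ 2 - (2 * cubB y v - cub y * ‖v‖ ^ 2) =
        s * (2 * cubB d v - (ρ ^ 2 * cubB d m + s ^ 2 / 4 * cub d) * ‖v‖ ^ 2) := by
      linear_combination 2 * e1 - ‖v‖ ^ 2 * e2
    -- As ρ² + s²/4 = 1, this is the convex combination of the two inequalities for v.
    have e4 : (ρ ^ 2 * cubB d m + s ^ 2 / 4 * cub d + c) * ‖v‖ ^ 2 ≤ 2 * cubB d v := by
      have i1 := mul_le_mul_of_nonneg_left hv3.le (sq_nonneg ρ)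
      have i2 := mul_le_mul_of_nonneg_left hv4.le (show 0 ≤ s ^ 2 / 4 by positivity)
      have e5 : (ρ ^ 2 * cubB d m + s ^ 2 / 4 * cub d + c) * ‖v‖ ^ 2 =
          ρ ^ 2 * ((cubB d m + c) * ‖v‖ ^ 2) + s ^ 2 / 4 * ((cub d + c) * ‖v‖ ^ 2) := by
        linear_combination -c * ‖v‖ ^ 2 * hρ
      have e6 : 2 * cubB d v = ρ ^ 2 * (2 * cubB d v) + s ^ 2 / 4 * (2 * cubB d v) := by
        linear_combination -2 * cubB d v * hρ
      linarith
    rw [e3]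
    have := mul_le_mul_of_nonneg_left e4 hs.le
    linarith
  refine ⟨‖v‖⁻¹ • v, by rw [norm_smul, norm_inv, norm_norm, inv_mul_cancel₀ hvp.ne'], ?_⟩
  rw [qf_smul_right, qf_smul_right, ← mul_sub, inv_pow, inv_mul_eq_div,
    le_div_iff₀ (by positivity)]
  exact hmain

theorem profile_w : Profile w where
  smooth := contDiffOn_w
  hom t ht x := by
    rw [w_eq, w_eq, cub_smul, norm_smul, Real.norm_of_nonneg ht.le]
    rcases eq_or_ne x 0 with rfl | hx
    · simp
    · have := norm_ne_zero_iff.2 hx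
      field_simp
  odd x := by
    have h := cub_smul (-1) x
    rw [neg_one_smul] at h
    rw [w_eq, w_eq, h, norm_neg]
    ring
  nontrivial := by
    let x : E 12 := ofQuat fun _ => 1
    have h1 : cub x = 1 := by simp [x, cub]
    have hx : x ≠ 0 := by
      intro h
      have h2 : cub ((2 : ℝ) • x) = cub x := by rw [h, smul_zero]
      rw [cub_smul, h1] at h2
      norm_num at h2
    exact ⟨x, by rw [w_eq, h1]; simpa using hx⟩

/-! ### Mollification and the Lipschitz elliptic function -/

open MeasureTheory in
/-- Mollification of a Lipschitz function. -/
theorem exists_smooth_approx {V : Type*} [NormedAddCommGroup V] [NormedSpace ℝ V]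
    [FiniteDimensional ℝ V] {f : V → ℝ} {L : NNReal} (hf : LipschitzWith L f) {ρ : ℝ}
    (hρ : 0 < ρ) : ∃ g : V → ℝ, ContDiff ℝ ∞ g ∧ (∀ x, |g x - f x| ≤ L * ρ) ∧
      ∀ (B : V) (m M : ℝ), (∀ C, m ≤ f (C + B) - f C ∧ f (C + B) - f C ≤ M) →
        ∀ A, m ≤ g (A + B) - g A ∧ g (A + B) - g A ≤ M := by
  let _ : MeasurableSpace V := borel V
  have : BorelSpace V := ⟨rfl⟩
  let μ : Measure V := Measure.addHaar
  let φ : ContDiffBump (0 : V) := ⟨ρ / 2, ρ, by positivity, by linarith⟩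
  -- Increments of the convolution are averages of increments of f, so uniform bounds on the latter,
  -- in particular ellipticity bounds, are inherited.
  let g : V → ℝ := convolution (φ.normed μ) f (ContinuousLinearMap.lsmul ℝ ℝ) μ
  have hg : ∀ x, g x = ∫ t, φ.normed μ t * f (x - t) ∂μ := fun x => rfl
  have hint : ∀ x, Integrable (fun t => φ.normed μ t * f (x - t)) μ := fun x =>
    (φ.continuous_normed.mul (hf.continuous.comp (by fun_prop))).integrable_of_hasCompactSupport
      φ.hasCompactSupport_normed.mul_right
  have hnint : Integrable (φ.normed μ) μ := φ.integrable_normed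
  refine ⟨g, ?_, fun x => ?_, fun B m M h A => ?_⟩
  · exact φ.hasCompactSupport_normed.contDiff_convolution_left _ φ.contDiff_normed
      hf.continuous.locallyIntegrable
  · rw [← Real.dist_eq]
    refine ContDiffBump.dist_normed_convolution_le hf.continuous.aestronglyMeasurable
      fun y hy => ?_
    refine (hf.dist_le_mul y x).trans ?_
    gcongr
    exact (mem_ball.1 hy).le
  · have e1 : g (A + B) - g A = ∫ t, φ.normed μ t * (f (A - t + B) - f (A - t)) ∂μ := by
      rw [hg, hg, ← integral_sub (hint _) (hint _)]
      refine integral_congr_ae (Eventually.of_forall fun t => ?_)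
      simp only
      rw [show A + B - t = A - t + B by abel]
      ring
    have hint2 : Integrable (fun t => φ.normed μ t * (f (A - t + B) - f (A - t))) μ := by
      have := (hint (A + B)).sub (hint A)
      refine this.congr (Eventually.of_forall fun t => ?_)
      simp only [Pi.sub_apply]
      rw [show A + B - t = A - t + B by abel]
      ring
    have e2 : ∀ c : ℝ, ∫ t, φ.normed μ t * c ∂μ = c := fun c => by
      rw [integral_mul_const, φ.integral_normed, one_mul]
    rw [e1]
    constructor
    · rw [← e2 m]
      exact integral_mono (hnint.mul_const m) hint2 fun t =>
        mul_le_mul_of_nonneg_left (h _).1 (φ.nonneg_normed t)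
    · rw [← e2 M]
      exact integral_mono hint2 (hnint.mul_const M) fun t =>
        mul_le_mul_of_nonneg_left (h _).2 (φ.nonneg_normed t)

theorem ciInf_add_le {ι : Type*} [Nonempty ι] {f g : ι → ℝ} (hf : BddBelow (range f)) {m : ℝ}
    (h : ∀ i, f i + m ≤ g i) : (⨅ i, f i) + m ≤ ⨅ i, g i :=
  le_ciInf fun i => (add_le_add_left (ciInf_le hf i) m).trans (h i)

/-- The largest eigenvalue. -/
def topEig (A : SymForm n) : ℝ := ⨆ v : sphere (0 : E n) 1, qf A v

theorem bddAbove_qf (A : SymForm n) : BddAbove (range fun v : sphere (0 : E n) 1 => qf A v) := by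
  refine ⟨‖A‖, ?_⟩
  rintro _ ⟨v, rfl⟩
  have := (abs_le.1 (abs_qf_le A v)).2
  simpa using this

theorem qf_le_topEig (A : SymForm n) {v : E n} (hv : ‖v‖ = 1) : qf A v ≤ topEig A :=
  le_ciSup (bddAbove_qf A) ⟨v, by simpa using hv⟩

theorem topEig_le (hn : 0 < n) {A B : SymForm n} {m : ℝ}
    (h : ∀ v : E n, ‖v‖ = 1 → qf A v ≤ qf B v + m) : topEig A ≤ topEig B + m := by
  have : Nonempty (Fin n) := ⟨⟨0, hn⟩⟩
  have : Nonempty (sphere (0 : E n) 1) :=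
    (NormedSpace.sphere_nonempty.2 zero_le_one).to_subtype
  refine ciSup_le fun v => ?_
  have hv : ‖(v : E n)‖ = 1 := by simp
  exact (h v hv).trans (by have := qf_le_topEig B hv; linarith)

/-- A maximal operator of Pucci type. -/
def pucci (K : ℝ) (A : SymForm n) : ℝ := trL A + K * topEig A

theorem pucci_add_le (hn : 0 < n) {K : ℝ} (hK : 0 ≤ K) (A B : SymForm n) :
    pucci K (A + B) ≤ pucci K A + (n + K) * ‖B‖ := by
  have h1 := (abs_le.1 (abs_trL_le B)).2
  have h2 : topEig (A + B) ≤ topEig A + ‖B‖ := topEig_le hn fun v hv => by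
    have := (abs_le.1 (abs_qf_le B v)).2
    rw [hv] at this
    simp only [qf_add]
    linarith
  have h3 := mul_le_mul_of_nonneg_left h2 hK
  simp only [pucci, map_add]
  linarith

theorem pucci_zero (hn : 0 < n) (K : ℝ) : pucci K (0 : SymForm n) = 0 := by
  have : Nonempty (Fin n) := ⟨⟨0, hn⟩⟩
  have : Nonempty (sphere (0 : E n) 1) :=
    (NormedSpace.sphere_nonempty.2 zero_le_one).to_subtype
  simp [pucci, topEig]

/-- The trace grows by exactly t and the largest eigenvalue by an amount between 0 and t. These
bounds do not depend on A, so they survive the infimum over translates. -/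
theorem pucci_add_rankOne (hn : 0 < n) {K : ℝ} (hK : 0 ≤ K) (A : SymForm n) {ξ : E n}
    (hξ : ‖ξ‖ = 1) {t : ℝ} (ht : 0 ≤ t) : pucci K A + t ≤ pucci K (A + t • rankOne ξ) ∧
      pucci K (A + t • rankOne ξ) ≤ pucci K A + (1 + K) * t := by
  have h0 : trL (rankOne ξ) = 1 := by rw [trL_rankOne, hξ]; norm_num
  have h1 : topEig A ≤ topEig (A + t • rankOne ξ) + 0 := topEig_le hn fun v _ => by
    simp only [qf_add, qf_smul, qf_rankOne]
    nlinarith [mul_nonneg ht (sq_nonneg (inner ℝ ξ v))]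
  have h2 : topEig (A + t • rankOne ξ) ≤ topEig A + t := topEig_le hn fun v hv => by
    simp only [qf_add, qf_smul, qf_rankOne]
    have := abs_real_inner_le_norm ξ v
    rw [hξ, hv, one_mul] at this
    have : inner ℝ ξ v ^ 2 ≤ 1 := (sq_le_one_iff_abs_le_one _).2 this
    nlinarith
  have h3 := mul_le_mul_of_nonneg_left h1 hK
  have h4 := mul_le_mul_of_nonneg_left h2 hK
  simp only [pucci, map_add, map_smul, h0, smul_eq_mul]
  constructor <;> linarith

/-- A Lipschitz uniformly elliptic function vanishing on a compact set with hyperbolic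
differences. -/
theorem exists_lipschitz_elliptic (hn : 0 < n) {S : Set (SymForm n)} (hS : IsCompact S)
    (hne : S.Nonempty) {c : ℝ} (hc : 0 < c)
    (hhyp : ∀ X ∈ S, ∀ Y ∈ S, ∃ v : E n, ‖v‖ = 1 ∧ c * ‖X - Y‖ ≤ qf (X - Y) v) :
    ∃ (f : SymForm n → ℝ) (L : NNReal) (M : ℝ), LipschitzWith L f ∧ (∀ X ∈ S, f X = 0) ∧
      ∀ ξ : E n, ‖ξ‖ = 1 → ∀ t : ℝ, 0 ≤ t → ∀ A,
        t ≤ f (A + t • rankOne ξ) - f A ∧ f (A + t • rankOne ξ) - f A ≤ M * t := by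
  -- With this K, for X, Y in S the term K·topEig(X - Y) ≥ n‖X - Y‖ outweighs the trace, which is at
  -- least -n‖X - Y‖. Hence every competitor at X ∈ S is nonnegative and Y = X gives 0.
  set K : ℝ := n / c with hKdef
  have hK : 0 ≤ K := by positivity
  have : Nonempty S := hne.to_subtype
  have hL : (0 : ℝ) ≤ n + K := by positivity
  have hneg : ∀ A : SymForm n, -((n + K) * ‖A‖) ≤ pucci K A := fun A => by
    have := pucci_add_le hn hK A (-A)
    rw [add_neg_cancel, pucci_zero hn, norm_neg] at this
    linarith
  obtain ⟨R, hR⟩ := hS.isBounded.exists_norm_le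
  have hbdd : ∀ A : SymForm n, BddBelow (range fun X : S => pucci K (A - (X : SymForm n))) := by
    intro A
    refine ⟨-((n + K) * (‖A‖ + R)), ?_⟩
    rintro _ ⟨X, rfl⟩
    refine le_trans ?_ (hneg _)
    have h1 := hR X X.2
    have h2 := norm_sub_le A (X : SymForm n)
    have := mul_le_mul_of_nonneg_left (h2.trans (add_le_add_right h1 _)) hL
    linarith
  let f : SymForm n → ℝ := fun A => ⨅ X : S, pucci K (A - (X : SymForm n))
  have hf : ∀ A B : SymForm n, ∀ m, (∀ X : SymForm n, pucci K (A - X) + m ≤ pucci K (B - X)) →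
      f A + m ≤ f B := fun A B m h => ciInf_add_le (hbdd A) fun X => h X
  have hlip : ∀ A B, f A ≤ f B + (n + K) * ‖A - B‖ := fun A B => by
    have := hf A B (-((n + K) * ‖A - B‖)) fun X => by
      have := pucci_add_le hn hK (B - X) (A - B)
      rw [show B - X + (A - B) = A - X by abel] at this
      linarith
    linarith
  refine ⟨f, ⟨n + K, hL⟩, 1 + K, LipschitzWith.of_le_add_mul _ fun A B => ?_, fun X hX => ?_,
    fun ξ hξ t ht A => ⟨?_, ?_⟩⟩
  · rw [dist_eq_norm]; exact hlip A B
  · refine le_antisymm ?_ (le_ciInf fun Y => ?_)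
    · exact (ciInf_le (hbdd X) ⟨X, hX⟩).trans (by rw [sub_self, pucci_zero hn])
    · obtain ⟨v, hv, hcv⟩ := hhyp X hX Y Y.2
      have h1 := (abs_le.1 (abs_trL_le (X - (Y : SymForm n)))).1
      have h2 := mul_le_mul_of_nonneg_left (hcv.trans (qf_le_topEig _ hv)) hK
      have h3 : K * (c * ‖X - (Y : SymForm n)‖) = n * ‖X - (Y : SymForm n)‖ := by
        rw [hKdef]; field_simp
      simp only [pucci]
      linarith
  · have := hf A (A + t • rankOne ξ) t fun X => by
      have := (pucci_add_rankOne hn hK (A - X) hξ ht).1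
      rwa [show A - X + t • rankOne ξ = A + t • rankOne ξ - X by abel] at this
    linarith
  · have := hf (A + t • rankOne ξ) A (-((1 + K) * t)) fun X => by
      have := (pucci_add_rankOne hn hK (A - X) hξ ht).2
      rw [show A - X + t • rankOne ξ = A + t • rankOne ξ - X by abel] at this
      linarith
    linarith

/-! ### A smooth elliptic function near the image of the sphere -/

theorem eventually_lt_fderiv {V : Type*} [NormedAddCommGroup V] [NormedSpace ℝ V] {f : V → ℝ}
    {x : V} (hf : ContDiffAt ℝ ω f x) {δ : ℝ} (hδ : 0 < δ) :
    ∀ᶠ y in 𝓝 x, ∀ v, fderiv ℝ f x v - δ / 2 * ‖v‖ ≤ fderiv ℝ f y v := by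
  have hc : ContinuousAt (fderiv ℝ f) x := (hf.fderiv_right (m := 0) (by simp)).continuousAt
  filter_upwards [hc (Metric.ball_mem_nhds (fderiv ℝ f x) (half_pos hδ))] with y hy v
  have hy : ‖fderiv ℝ f y - fderiv ℝ f x‖ < δ / 2 := mem_ball_iff_norm.1 (mem_preimage.1 hy)
  have h1 := (abs_le.1 ((fderiv ℝ f y - fderiv ℝ f x).le_opNorm v)).1
  have h2 := mul_le_mul_of_nonneg_right hy.le (norm_nonneg v)
  rw [sub_apply] at h1
  linarith

/-- An analytic map on `ℝⁿ \ {0}`, positively homogeneous of degree zero, such that differences of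
values on the unit sphere have quantitatively positive directions. -/
structure HyperbolicMap (H : E n → SymForm n) (c : ℝ) : Prop where
  smooth : ∀ x ≠ 0, ContDiffAt ℝ ω H x
  hom : ∀ t : ℝ, 0 < t → ∀ x, H (t • x) = H x
  pos : 0 < c
  hyp : ∀ x y : E n, ‖x‖ = 1 → ‖y‖ = 1 → ∃ v : E n, ‖v‖ = 1 ∧ c * ‖x - y‖ ≤ qf (H x) v - qf (H y) v

namespace HyperbolicMap

variable {H : E n → SymForm n} {c : ℝ}

theorem hasFDerivAt (hH : HyperbolicMap H c) {x : E n} (hx : x ≠ 0) :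
    HasFDerivAt H (fderiv ℝ H x) x :=
  ((hH.smooth x hx).differentiableAt (by simp)).hasFDerivAt

theorem hasDerivAt_line (hH : HyperbolicMap H c) {x : E n} (hx : x ≠ 0) (ξ : E n) :
    HasDerivAt (fun t : ℝ => H (x + t • ξ)) (fderiv ℝ H x ξ) 0 := by
  have h1 : HasDerivAt (fun t : ℝ => x + t • ξ) ξ 0 := by
    simpa using ((hasDerivAt_id (0 : ℝ)).smul_const ξ).const_add x
  have h2 : HasFDerivAt H (fderiv ℝ H x) (x + (0 : ℝ) • ξ) := by
    simpa using hH.hasFDerivAt hx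
  exact h2.comp_hasDerivAt 0 h1

/-- Euler's relation for degree zero: H is constant along rays. -/
theorem fderiv_self (hH : HyperbolicMap H c) {x : E n} (hx : x ≠ 0) : fderiv ℝ H x x = 0 := by
  have h1 := hH.hasDerivAt_line hx x
  have h2 : (fun t : ℝ => H (x + t • x)) =ᶠ[𝓝 0] fun _ => H x := by
    filter_upwards [lt_mem_nhds (show (-1 : ℝ) < 0 by norm_num)] with t ht
    rw [show x + t • x = (1 + t) • x by module, hH.hom _ (by linarith)]
  exact h1.unique ((hasDerivAt_const 0 (H x)).congr_of_eventuallyEq h2)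

theorem fderiv_smul_self (hH : HyperbolicMap H c) {x : E n} (hx : x ≠ 0) (a : ℝ) :
    fderiv ℝ H x (a • x) = 0 := by
  rw [map_smul, hH.fderiv_self hx]
  apply ext_qf; intro v; rw [qf_smul, qf_zero, mul_zero]

theorem norm_sub_le (hH : HyperbolicMap H c) {x y : E n} (hx : ‖x‖ = 1) (hy : ‖y‖ = 1) :
    c * ‖x - y‖ ≤ ‖H x - H y‖ := by
  obtain ⟨v, hv, h⟩ := hH.hyp x y hx hy
  have := (abs_le.1 (abs_qf_le (H x - H y) v)).2
  rw [hv, qf_sub] at this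
  linarith

/-- The derivative is not positive semidefinite in nonzero tangential directions. -/
theorem exists_qf_fderiv_neg (hH : HyperbolicMap H c) {x ξ : E n} (hx : ‖x‖ = 1)
    (hxξ : inner ℝ x ξ = 0) (hξ : ξ ≠ 0) : ∃ v, qf (fderiv ℝ H x ξ) v < 0 := by
  by_contra! hcon
  have hx0 : x ≠ 0 := by intro h; simp [h] at hx
  have hξ0 : 0 < ‖ξ‖ := norm_pos_iff.2 hξ
  have hc := hH.pos
  have hε : 0 < c * ‖ξ‖ / 4 := by positivity
  have h1 := (hasDerivAt_iff_isLittleO.1 (hH.hasDerivAt_line hx0 ξ)).def hε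
  have h2 : ∀ᶠ t : ℝ in 𝓝 0, t * ‖ξ‖ < 1 :=
    (Continuous.tendsto (by fun_prop) 0).eventually_lt_const (by simp)
  obtain ⟨t, ⟨ht1, ht2⟩, ht⟩ := (((h1.and h2).filter_mono
    (nhdsWithin_le_nhds (s := Ioi 0))).and self_mem_nhdsWithin).exists
  have ht : 0 < t := ht
  simp only [zero_smul, add_zero, sub_zero, Real.norm_of_nonneg ht.le] at ht1
  set y := x + t • ξ with hy
  have hny : ‖y‖ ^ 2 = 1 + t ^ 2 * ‖ξ‖ ^ 2 := by
    rw [hy, norm_add_sq_real, inner_smul_right, hxξ, hx, norm_smul, mul_pow, Real.norm_eq_abs,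
      sq_abs]
    ring
  have hny0 : 0 < ‖y‖ := by
    by_contra! h
    have : ‖y‖ = 0 := le_antisymm h (norm_nonneg _)
    rw [this] at hny
    nlinarith [sq_nonneg (t * ‖ξ‖)]
  have hny2 : ‖y‖ ≤ 2 := by nlinarith [mul_pos ht hξ0]
  set u := ‖y‖⁻¹ • y with hu
  have hu1 : ‖u‖ = 1 := by rw [hu, norm_smul, norm_inv, norm_norm, inv_mul_cancel₀ hny0.ne']
  have hHu : H u = H y := hH.hom _ (by positivity) y
  -- The component of u - x along ξ/|ξ| is t|ξ|/|y|, and |y| ≤ 2. Hyperbolicity thus forces a drop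
  -- of at least ct|ξ|/2, twice the linearization error allowed by the choice of c|ξ|/4.
  have hdist : t * ‖ξ‖ / 2 ≤ ‖x - u‖ := by
    have h3 : inner ℝ (u - x) ξ = ‖y‖⁻¹ * (t * ‖ξ‖ ^ 2) := by
      rw [inner_sub_left, hxξ, hu, inner_smul_left, hy, inner_add_left, hxξ, inner_smul_left,
        real_inner_self_eq_norm_sq]
      simp
    have h4 := real_inner_le_norm (u - x) ξ
    rw [h3, norm_sub_rev] at h4
    have h5 : t * ‖ξ‖ ^ 2 ≤ ‖y‖ * (‖x - u‖ * ‖ξ‖) := by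
      rw [inv_mul_eq_div, div_le_iff₀ hny0] at h4
      linarith
    have h6 : t * ‖ξ‖ ≤ ‖y‖ * ‖x - u‖ := by
      refine le_of_mul_le_mul_right ?_ hξ0
      linarith
    nlinarith [norm_nonneg (x - u)]
  obtain ⟨v, hv, hcv⟩ := hH.hyp x u hx hu1
  rw [hHu] at hcv
  have h7 := (abs_le.1 (abs_qf_le (H y - H x - t • fderiv ℝ H x ξ) v)).1
  simp only [qf_sub, qf_smul, hv, one_pow, mul_one] at h7
  have h8 := mul_nonneg ht.le (hcon v)
  have h9 := mul_le_mul_of_nonneg_left hdist hc.le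
  nlinarith [mul_pos (mul_pos hc ht) hξ0]

/-- The radial part of ξ does not contribute to the derivative, so a nonzero tangential part would
produce a negative direction. -/
theorem eq_zero_of_fderiv_nonneg (hH : HyperbolicMap H c) {x ξ : E n} (hx : ‖x‖ = 1)
    (h : ∀ v, 0 ≤ qf (fderiv ℝ H x ξ) v) : ξ = inner ℝ x ξ • x := by
  have hx0 : x ≠ 0 := by intro h; simp [h] at hx
  by_contra hne
  have hne' : ξ - inner ℝ x ξ • x ≠ 0 := sub_ne_zero.2 hne
  have horth : inner ℝ x (ξ - inner ℝ x ξ • x) = 0 := by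
    rw [inner_sub_right, inner_smul_right, real_inner_self_eq_norm_sq, hx]; ring
  obtain ⟨v, hv⟩ := hH.exists_qf_fderiv_neg hx horth hne'
  rw [map_sub, hH.fderiv_smul_self hx0, sub_zero] at hv
  exact absurd (h v) (not_le.2 hv)

/-- A positive definite functional annihilating the image of the derivative. -/
theorem exists_functional (hH : HyperbolicMap H c) {x : E n} (hx : ‖x‖ = 1) :
    ∃ (M : SymForm n →L[ℝ] ℝ) (δ : ℝ), 0 < δ ∧ (∀ ξ, M (fderiv ℝ H x ξ) = 0) ∧
      ∀ ξ, δ * ‖ξ‖ ^ 2 ≤ M (rankOne ξ) := by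
  have hx0 : x ≠ 0 := by intro h; simp [h] at hx
  let K : Set (SymForm n) := {A | (∀ v, 0 ≤ qf A v) ∧ trL A = 1}
  have hcq : ∀ v : E n, Continuous fun A : SymForm n => qf A v := fun v => (qfL v).continuous
  have hKclosed : IsClosed K := by
    have : K = (⋂ v, {A | 0 ≤ qf A v}) ∩ {A | trL A = 1} := by
      ext A; simp [K]
    rw [this]
    exact (isClosed_iInter fun v => isClosed_le continuous_const (hcq v)).inter
      (isClosed_eq trL.continuous continuous_const)
  have hKcompact : IsCompact K := by
    refine Metric.isCompact_of_isClosed_isBounded hKclosed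
      ((isBounded_closedBall (x := (0 : SymForm n)) (r := 1)).subset fun A hA => ?_)
    rw [mem_closedBall_zero_iff, ← hA.2]
    exact norm_le_trL hA.1
  have hKconvex : Convex ℝ K := by
    intro A hA B hB a b ha hb hab
    refine ⟨fun v => ?_, ?_⟩
    · have h1 := mul_nonneg ha (hA.1 v)
      have h2 := mul_nonneg hb (hB.1 v)
      simp only [qf_add, qf_smul]
      linarith
    · simp only [map_add, map_smul, hA.2, hB.2, smul_eq_mul]
      linarith
  let W : Submodule ℝ (SymForm n) := LinearMap.range (fderiv ℝ H x : E n →ₗ[ℝ] SymForm n)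
  -- A positive semidefinite value of the derivative comes from a radial vector, hence is zero and
  -- cannot have trace one.
  have hdisj : Disjoint K (W : Set (SymForm n)) := by
    rw [Set.disjoint_left]
    rintro A hA ⟨ξ, rfl⟩
    have h1 := hH.eq_zero_of_fderiv_nonneg hx hA.1
    have h2 : fderiv ℝ H x ξ = 0 := by
      rw [h1, hH.fderiv_smul_self hx0]
    have h3 := hA.2
    simp only [ContinuousLinearMap.coe_coe, h2, map_zero] at h3
    exact zero_ne_one h3
  obtain ⟨f, u, v, hfu, huv, hvf⟩ := geometric_hahn_banach_compact_closed hKconvex hKcompact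
    W.convex W.closed_of_finiteDimensional hdisj
  have hv0 : v < 0 := by simpa using hvf 0 W.zero_mem
  -- A linear functional bounded below on a subspace vanishes on it.
  have hW : ∀ ξ, f (fderiv ℝ H x ξ) = 0 := by
    intro ξ
    by_contra hne
    have h1 := hvf _ (W.smul_mem (v / f (fderiv ℝ H x ξ)) ⟨ξ, rfl⟩)
    simp only [ContinuousLinearMap.coe_coe, map_smul, smul_eq_mul, div_mul_cancel₀ _ hne] at h1
    exact lt_irrefl _ h1
  refine ⟨-f, -u, by linarith, fun ξ => by simp [hW ξ], fun ξ => ?_⟩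
  rcases eq_or_ne ξ 0 with rfl | hξ
  · have : rankOne (0 : E n) = 0 := by apply ext_qf; simp
    simp [this]
  · have hn := norm_pos_iff.2 hξ
    have h1 : rankOne (‖ξ‖⁻¹ • ξ) ∈ K := by
      refine ⟨fun v => by rw [qf_rankOne]; positivity, ?_⟩
      rw [trL_rankOne, norm_smul, norm_inv, norm_norm, inv_mul_cancel₀ hn.ne']; norm_num
    have h2 := hfu _ h1
    rw [rankOne_smul, map_smul, smul_eq_mul, inv_pow, inv_mul_eq_div,
      div_lt_iff₀ (by positivity)] at h2
    simp only [neg_apply]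
    linarith

/-- An analytic local left inverse of `H` on the unit sphere. -/
theorem exists_leftInverse (hH : HyperbolicMap H c) {x : E n} (hx : ‖x‖ = 1) :
    ∃ r : SymForm n → E n, ContDiffAt ℝ ω r (H x) ∧
      ∀ᶠ y in 𝓝 x, ‖y‖ = 1 → r (H y) = y := by
  have hx0 : x ≠ 0 := by intro h; simp [h] at hx
  let T : E n →ₗ[ℝ] SymForm n × ℝ :=
    (fderiv ℝ H x : E n →ₗ[ℝ] SymForm n).prod (innerSL ℝ x : E n →ₗ[ℝ] ℝ)
  have hT : LinearMap.ker T = ⊥ := by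
    rw [LinearMap.ker_eq_bot']
    intro ξ hξ
    have h1 : fderiv ℝ H x ξ = 0 := congrArg Prod.fst hξ
    have h2 : inner ℝ x ξ = 0 := congrArg Prod.snd hξ
    have h3 := hH.eq_zero_of_fderiv_nonneg hx (ξ := ξ) fun v => by rw [h1]; simp
    rw [h3, h2, zero_smul]
  obtain ⟨G₀, hG₀⟩ := T.exists_leftInverse_of_injective hT
  let G : SymForm n × ℝ →L[ℝ] E n := LinearMap.toContinuousLinearMap G₀
  -- The second slot restores the radial direction killed by the derivative of H, so k has identity
  -- derivative at x. On the unit sphere that slot is the constant 1/2, and k depends on y only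
  -- through H y.
  let k : E n → E n := fun y => G (H y, (1 / 2 : ℝ) * ‖y‖ ^ 2)
  have hk : ContDiffAt ℝ ω k x :=
    G.contDiff.contDiffAt.comp x
      ((hH.smooth x hx0).prodMk (contDiffAt_const.mul (contDiff_norm_sq ℝ).contDiffAt))
  have hkd : HasFDerivAt k ((ContinuousLinearEquiv.refl ℝ (E n) : E n ≃L[ℝ] E n) :
      E n →L[ℝ] E n) x := by
    have h1 : HasFDerivAt (fun y : E n => (1 / 2 : ℝ) * ‖y‖ ^ 2) (innerSL ℝ x) x := by
      refine ((hasStrictFDerivAt_norm_sq x).hasFDerivAt.const_mul (1 / 2)).congr_fderiv ?_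
      ext z; simp
    refine (G.hasFDerivAt.comp x ((hH.hasFDerivAt hx0).prodMk h1)).congr_fderiv ?_
    ext1 ξ
    exact LinearMap.congr_fun hG₀ ξ
  let g := hk.localInverse hkd (by simp)
  refine ⟨fun A => g (G (A, 1 / 2)), ?_, ?_⟩
  · have hkx : k x = G (H x, 1 / 2) := by simp [k, hx]
    have hg : ContDiffAt ℝ ω g (G (H x, 1 / 2)) := by
      rw [← hkx]; exact hk.to_localInverse hkd (by simp)
    exact hg.comp (H x) (G.contDiff.contDiffAt.comp (H x) (contDiffAt_id.prodMk contDiffAt_const))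
  · have hev := (hk.hasStrictFDerivAt' hkd (by simp)).eventually_left_inverse
    filter_upwards [hev] with y hy hy1
    have : k y = G (H y, 1 / 2) := by simp [k, hy1]
    change g (G (H y, 1 / 2)) = y
    rw [← this]
    exact hy

/-- Local smooth elliptic functions vanishing on the image of the sphere. -/
theorem exists_local (hH : HyperbolicMap H c) {x : E n} (hx : ‖x‖ = 1) :
    ∃ f : SymForm n → ℝ, ∀ᶠ A in 𝓝 (H x), ContDiffAt ℝ ∞ f A ∧
      (A ∈ H '' sphere 0 1 → f A = 0) ∧ ∀ ξ, ξ ≠ 0 → 0 < fderiv ℝ f A (rankOne ξ) := by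
  have hx0 : x ≠ 0 := by intro h; simp [h] at hx
  obtain ⟨M, δ, hδ, hM0, hMpos⟩ := hH.exists_functional hx
  obtain ⟨r, hr, hry⟩ := hH.exists_leftInverse hx
  have hrx : r (H x) = x := hry.self_of_nhds hx
  -- On the image of the sphere near H x, r inverts H and f vanishes. The derivative at H x is M,
  -- because M annihilates the range of the derivative of H.
  let f : SymForm n → ℝ := fun A => M (A - H (r A))
  have hHr : ContDiffAt ℝ ω H (r (H x)) := by rw [hrx]; exact hH.smooth x hx0
  have hf : ContDiffAt ℝ ω f (H x) :=
    M.contDiff.contDiffAt.comp (H x) (contDiffAt_id.sub (hHr.comp (H x) hr))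
  have hfd : fderiv ℝ f (H x) = M := by
    have h1 : HasFDerivAt H (fderiv ℝ H x) (r (H x)) := by rw [hrx]; exact hH.hasFDerivAt hx0
    have h2 := h1.comp (H x) (hr.differentiableAt (by simp)).hasFDerivAt
    have h3 : HasFDerivAt f (M.comp (ContinuousLinearMap.id ℝ (SymForm n) -
        (fderiv ℝ H x).comp (fderiv ℝ r (H x)))) (H x) :=
      M.hasFDerivAt.comp (H x) ((hasFDerivAt_id (H x)).sub h2)
    rw [h3.fderiv]
    ext B
    simp [hM0]
  -- `ContDiffAt` persists to a neighbourhood for `ω` but in general not for `∞`; hence the analytic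
  -- hypothesis on H.
  have e1 : ∀ᶠ A in 𝓝 (H x), ContDiffAt ℝ ∞ f A := by
    filter_upwards [hf.eventually (by simp)] with A hA
    exact hA.of_le le_top
  have e2 : ∀ᶠ A in 𝓝 (H x), A ∈ H '' sphere 0 1 → f A = 0 := by
    obtain ⟨ρ, hρ, hball⟩ := Metric.eventually_nhds_iff_ball.1 hry
    filter_upwards [Metric.ball_mem_nhds (H x) (mul_pos hH.pos hρ)] with A hA
    -- The lower bound `norm_sub_le` turns closeness of H y to H x into closeness of y to x, where
    -- the left inverse is valid.
    rintro ⟨y, hy, rfl⟩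
    have hy1 : ‖y‖ = 1 := by simpa using hy
    have h1 := hH.norm_sub_le hy1 hx
    rw [mem_ball, dist_eq_norm] at hA
    have h2 : ‖y - x‖ < ρ := lt_of_mul_lt_mul_left (h1.trans_lt hA) hH.pos.le
    have h3 := hball y (by rw [mem_ball, dist_eq_norm]; exact h2) hy1
    simp [f, h3]
  have e3 : ∀ᶠ A in 𝓝 (H x), ∀ ξ, ξ ≠ 0 → 0 < fderiv ℝ f A (rankOne ξ) := by
    filter_upwards [eventually_lt_fderiv hf hδ] with A hA ξ hξ
    have h1 := hMpos ξ
    have h2 := hA (rankOne ξ)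
    have h3 := mul_le_mul_of_nonneg_left (norm_rankOne_le ξ) (half_pos hδ).le
    have h4 : 0 < δ / 2 * ‖ξ‖ ^ 2 := by have := norm_pos_iff.2 hξ; positivity
    rw [hfd] at h2
    linarith
  refine ⟨f, ?_⟩
  filter_upwards [e1, e2, e3] with A h1 h2 h3 using ⟨h1, h2, h3⟩

theorem isCompact_image (hH : HyperbolicMap H c) : IsCompact (H '' sphere 0 1) :=
  (isCompact_sphere _ _).image_of_continuousOn fun x hx =>
    (hH.smooth x (ne_of_mem_sphere hx one_ne_zero)).continuousAt.continuousWithinAt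

/-- A compactly supported smooth function vanishing on the image of the sphere and strictly
elliptic there. -/
theorem exists_smooth_elliptic_near (hH : HyperbolicMap H c) :
    ∃ f : SymForm n → ℝ, ContDiff ℝ ∞ f ∧ HasCompactSupport f ∧
      (∀ A ∈ H '' sphere 0 1, f A = 0) ∧
      ∀ A ∈ H '' sphere 0 1, ∀ ξ, ξ ≠ 0 → 0 < fderiv ℝ f A (rankOne ξ) := by
  set S := H '' sphere 0 1 with hS
  -- Ellipticity on all of S is kept in the weak form, so that adding two functions preserves strict
  -- positivity wherever either has it.
  have key := hH.isCompact_image.induction_on (p := fun T => ∃ f : SymForm n → ℝ,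
    ContDiff ℝ ∞ f ∧ HasCompactSupport f ∧ (∀ A ∈ S, f A = 0) ∧
    (∀ A ∈ S, ∀ ξ, 0 ≤ fderiv ℝ f A (rankOne ξ)) ∧
    ∀ A ∈ T, A ∈ S → ∀ ξ, ξ ≠ 0 → 0 < fderiv ℝ f A (rankOne ξ)) ?_ ?_ ?_ ?_
  · obtain ⟨f, h1, h2, h3, -, h5⟩ := key
    exact ⟨f, h1, h2, h3, fun A hA => h5 A hA hA⟩
  · exact ⟨0, contDiff_const, HasCompactSupport.zero, by simp, by simp, by simp⟩
  · rintro T T' hTT' ⟨f, h1, h2, h3, h4, h5⟩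
    exact ⟨f, h1, h2, h3, h4, fun A hA => h5 A (hTT' hA)⟩
  · rintro T T' ⟨f, h1, h2, h3, h4, h5⟩ ⟨f', h1', h2', h3', h4', h5'⟩
    have hd : ∀ A, fderiv ℝ (f + f') A = fderiv ℝ f A + fderiv ℝ f' A := fun A =>
      fderiv_add (h1.differentiable (by simp) A) (h1'.differentiable (by simp) A)
    refine ⟨f + f', h1.add h1', h2.add h2', fun A hA => by simp [h3 A hA, h3' A hA],
      fun A hA ξ => ?_, ?_⟩
    · rw [hd]; exact add_nonneg (h4 A hA ξ) (h4' A hA ξ)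
    · rintro A (hA | hA) hAS ξ hξ
      · rw [hd]; exact add_pos_of_pos_of_nonneg (h5 A hA hAS ξ hξ) (h4' A hAS ξ)
      · rw [hd]; exact add_pos_of_nonneg_of_pos (h4 A hAS ξ) (h5' A hA hAS ξ hξ)
  · rintro _ ⟨x, hx, rfl⟩
    have hx1 : ‖x‖ = 1 := by simpa using hx
    obtain ⟨f, hf⟩ := hH.exists_local hx1
    obtain ⟨r, hr, hball⟩ := nhds_basis_closedBall.mem_iff.1 hf
    let χ : ContDiffBump (H x) := ⟨r / 2, r, by positivity, by linarith⟩
    have hzero : ∀ A, A ∉ closedBall (H x) r → (fun B => χ B * f B) =ᶠ[𝓝 A] fun _ => 0 := by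
      intro A hA
      filter_upwards [isClosed_closedBall.isOpen_compl.mem_nhds hA] with B hB
      have : r ≤ dist B (H x) := (not_le.1 (show ¬ dist B (H x) ≤ r from hB)).le
      rw [χ.zero_of_le_dist this, zero_mul]
    -- As f vanishes on S, the derivative of the cutoff drops out there.
    have hder : ∀ A ∈ S, A ∈ closedBall (H x) r → ∀ ξ,
        fderiv ℝ (fun B => χ B * f B) A (rankOne ξ) = χ A * fderiv ℝ f A (rankOne ξ) := by
      intro A hAS hA ξ
      obtain ⟨g1, g2, -⟩ := hball hA
      rw [fderiv_fun_mul (χ.contDiff.differentiable (n := ∞) (by simp) A)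
        (g1.differentiableAt (by simp)), g2 hAS]
      simp
    refine ⟨_, mem_nhdsWithin_of_mem_nhds (ball_mem_nhds (H x) (half_pos hr)),
      fun B => χ B * f B, ?_, χ.hasCompactSupport.mul_right, fun A hA => ?_, fun A hA ξ => ?_,
      fun A hA hAS ξ hξ => ?_⟩
    · rw [contDiff_iff_contDiffAt]
      intro A
      by_cases hA : A ∈ closedBall (H x) r
      · exact χ.contDiffAt.mul (hball hA).1
      · exact contDiffAt_const.congr_of_eventuallyEq (hzero A hA)
    · by_cases hAr : A ∈ closedBall (H x) r
      · simp [(hball hAr).2.1 hA]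
      · exact (hzero A hAr).self_of_nhds
    · by_cases hAr : A ∈ closedBall (H x) r
      · rw [hder A hA hAr]
        rcases eq_or_ne ξ 0 with rfl | hξ
        · have : rankOne (0 : E n) = 0 := by apply ext_qf; simp
          simp [this]
        · exact mul_nonneg χ.nonneg ((hball hAr).2.2 ξ hξ).le
      · rw [(hzero A hAr).fderiv_eq]; simp
    · have hAr : A ∈ closedBall (H x) r :=
        closedBall_subset_closedBall (by linarith) (ball_subset_closedBall hA)
      have h1 : χ A = 1 := χ.one_of_mem_closedBall (ball_subset_closedBall hA)
      rw [hder A hAS hAr, h1, one_mul]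
      exact (hball hAr).2.2 ξ hξ

end HyperbolicMap

/-! ### Cutoffs adapted to the distance function -/

section Cutoff

variable {V : Type*} [NormedAddCommGroup V] [NormedSpace ℝ V]

/-- Bounds on forward difference quotients pass to the derivative. -/
theorem fderiv_bounds {g : V → ℝ} {A B : V} (hg : DifferentiableAt ℝ g A) {m M : ℝ}
    (h : ∀ t : ℝ, 0 ≤ t → t * m ≤ g (A + t • B) - g A ∧ g (A + t • B) - g A ≤ t * M) :
    m ≤ fderiv ℝ g A B ∧ fderiv ℝ g A B ≤ M := by
  have h1 : HasDerivAt (fun t : ℝ => A + t • B) B 0 := by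
    simpa using ((hasDerivAt_id (0 : ℝ)).smul_const B).const_add A
  have h2 : HasFDerivAt g (fderiv ℝ g A) (A + (0 : ℝ) • B) := by simpa using hg.hasFDerivAt
  have h3 := (h2.comp_hasDerivAt 0 h1).tendsto_slope_zero_right
  simp only [zero_add, Function.comp_apply, zero_smul, add_zero, smul_eq_mul] at h3
  constructor
  · refine ge_of_tendsto h3 ?_
    filter_upwards [self_mem_nhdsWithin] with t ht
    have ht : 0 < t := ht
    rw [inv_mul_eq_div, le_div_iff₀ ht, mul_comm]
    exact (h t ht.le).1
  · refine le_of_tendsto h3 ?_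
    filter_upwards [self_mem_nhdsWithin] with t ht
    have ht : 0 < t := ht
    rw [inv_mul_eq_div, div_le_iff₀ ht, mul_comm]
    exact (h t ht.le).2

theorem exists_deriv_smoothTransition_le : ∃ C, 0 ≤ C ∧ ∀ t, |deriv Real.smoothTransition t| ≤ C := by
  have hc : Continuous (deriv Real.smoothTransition) :=
    (Real.smoothTransition.contDiff (n := 1)).continuous_deriv (by simp)
  obtain ⟨C, hC⟩ := (isCompact_Icc (a := (0 : ℝ)) (b := 1)).exists_bound_of_continuousOn
    hc.continuousOn
  refine ⟨|C|, abs_nonneg C, fun t => ?_⟩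
  rcases le_total t 0 with h | h
  · have : IsLocalMin Real.smoothTransition t := Eventually.of_forall fun s => by
      rw [Real.smoothTransition.zero_of_nonpos h]; exact Real.smoothTransition.nonneg s
    rw [this.deriv_eq_zero]; simp
  rcases le_total 1 t with h' | h'
  · have : IsLocalMax Real.smoothTransition t := Eventually.of_forall fun s => by
      rw [Real.smoothTransition.one_of_one_le h']; exact Real.smoothTransition.le_one s
    rw [this.deriv_eq_zero]; simp
  · exact (hC t ⟨h, h'⟩).trans (le_abs_self C)

theorem exists_fderiv_le_fderiv {f : V → ℝ} (hf : ContDiff ℝ ∞ f) (hcs : HasCompactSupport f)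
    {ε : ℝ} (hε : 0 < ε) : ∃ r, 0 < r ∧ ∀ A B, dist A B < r → ∀ v,
      fderiv ℝ f B v - ε * ‖v‖ ≤ fderiv ℝ f A v := by
  have huc : UniformContinuous (fderiv ℝ f) :=
    (hcs.fderiv ℝ).uniformContinuous_of_continuous (hf.continuous_fderiv (by simp))
  obtain ⟨r, hr, hrd⟩ := Metric.uniformContinuous_iff.1 huc ε hε
  refine ⟨r, hr, fun A B hAB v => ?_⟩
  have h1 : ‖fderiv ℝ f A - fderiv ℝ f B‖ < ε := mem_ball_iff_norm.1 (hrd hAB)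
  have h2 := (abs_le.1 ((fderiv ℝ f A - fderiv ℝ f B).le_opNorm v)).1
  have h3 := mul_le_mul_of_nonneg_right h1.le (norm_nonneg v)
  rw [sub_apply] at h2
  linarith

variable [FiniteDimensional ℝ V]

/-- The mollified distance is within ρ of the true one; adding 2ρ keeps it at least ρ, so that its
logarithm is smooth. -/
theorem exists_smooth_infDist (S : Set V) {ρ : ℝ} (hρ : 0 < ρ) :
    ∃ D : V → ℝ, ContDiff ℝ ∞ D ∧ (∀ A, infDist A S + ρ ≤ D A ∧ D A ≤ infDist A S + 3 * ρ) ∧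
      ∀ A B, |fderiv ℝ D A B| ≤ ‖B‖ := by
  obtain ⟨g, hg, hgd, hgB⟩ := exists_smooth_approx (lipschitz_infDist_pt S) hρ
  refine ⟨fun A => g A + 2 * ρ, hg.add contDiff_const, fun A => ?_, fun A B => ?_⟩
  · have := abs_le.1 (hgd A)
    simp only [NNReal.coe_one, one_mul] at this
    constructor <;> linarith
  · rw [fderiv_add_const, abs_le]
    refine fderiv_bounds (hg.differentiable (by simp) A) fun t ht => ?_
    refine hgB (t • B) _ _ (fun C => ?_) A
    have h1 := (lipschitz_infDist_pt S).dist_le_mul (C + t • B) C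
    rw [Real.dist_eq, dist_eq_norm, add_sub_cancel_left, norm_smul, Real.norm_of_nonneg ht] at h1
    have := abs_le.1 h1
    simp only [NNReal.coe_one, one_mul] at this
    constructor <;> linarith

/-- Cutoff functions near `S` whose derivative is small relative to the distance to `S`. -/
theorem exists_cutoff {S : Set V} {r ε : ℝ} (hr : 0 < r) (hε : 0 < ε) :
    ∃ (χ : V → ℝ) (ρ : ℝ), 0 < ρ ∧ ContDiff ℝ ∞ χ ∧ (∀ A, 0 ≤ χ A ∧ χ A ≤ 1) ∧
      (∀ A ∈ S, χ A = 1) ∧ (∀ A, r ≤ infDist A S → χ A = 0) ∧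
      ∀ A B, |fderiv ℝ χ A B| * (infDist A S + ρ) ≤ ε * ‖B‖ := by
  obtain ⟨C, hC0, hC⟩ := exists_deriv_smoothTransition_le
  set η : ℝ := ε / (C + 1) with hη
  have hη0 : 0 < η := by positivity
  have hCη : C * η ≤ ε := by
    rw [hη, mul_div_assoc', div_le_iff₀ (by positivity)]; nlinarith
  -- On S one has D ≤ 3ρ, and log(3ρ) = log r - 1/η, which is exactly what makes φ ≥ 1 there.
  set ρ : ℝ := r * Real.exp (-(1 / η)) / 3 with hρdef
  have hρ : 0 < ρ := by positivity
  obtain ⟨D, hD, hDd, hDB⟩ := exists_smooth_infDist S hρ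
  have hDpos : ∀ A, 0 < D A := fun A => by
    have := (hDd A).1; have := infDist_nonneg (x := A) (s := S); linarith
  -- The logarithmic profile gives a derivative of size at most η/D, and D dominates the distance
  -- plus ρ; a small η thus gives any prescribed ε.
  let φ : V → ℝ := fun A => η * (Real.log r - Real.log (D A))
  have hφ : ContDiff ℝ ∞ φ :=
    contDiff_const.mul (contDiff_const.sub (hD.log fun A => (hDpos A).ne'))
  refine ⟨fun A => Real.smoothTransition (φ A), ρ, hρ, Real.smoothTransition.contDiff.comp hφ,
    fun A => ⟨Real.smoothTransition.nonneg _, Real.smoothTransition.le_one _⟩, fun A hA => ?_,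
    fun A hA => ?_, fun A B => ?_⟩
  · apply Real.smoothTransition.one_of_one_le
    have h1 := (hDd A).2
    rw [infDist_zero_of_mem hA, zero_add] at h1
    have h2 := Real.log_le_log (hDpos A) h1
    have h3 : Real.log (3 * ρ) = Real.log r - 1 / η := by
      rw [hρdef, mul_div_cancel₀ _ (by norm_num), Real.log_mul hr.ne' (Real.exp_ne_zero _),
        Real.log_exp]
      ring
    rw [h3] at h2
    have h4 : η * (1 / η) ≤ φ A := mul_le_mul_of_nonneg_left (by linarith) hη0.le
    rwa [mul_one_div_cancel hη0.ne'] at h4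
  · apply Real.smoothTransition.zero_of_nonpos
    have h1 := (hDd A).1
    have h2 := Real.log_le_log hr (show r ≤ D A by linarith)
    exact mul_nonpos_of_nonneg_of_nonpos hη0.le (by linarith)
  · have e1 : HasFDerivAt φ (η • -((D A)⁻¹ • fderiv ℝ D A)) A :=
      (((hD.differentiable (by simp) A).hasFDerivAt.log (hDpos A).ne').const_sub _).const_mul η
    have e2 := ((Real.smoothTransition.contDiff (n := 1)).differentiable (by simp)
      (φ A)).hasDerivAt.comp_hasFDerivAt A e1
    have e3 : fderiv ℝ (fun A => Real.smoothTransition (φ A)) A B =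
        deriv Real.smoothTransition (φ A) * (η * -((D A)⁻¹ * fderiv ℝ D A B)) := by
      rw [show (fun A => Real.smoothTransition (φ A)) = Real.smoothTransition ∘ φ from rfl,
        e2.fderiv]
      rfl
    rw [e3, abs_mul, abs_mul, abs_neg, abs_mul, abs_of_pos hη0, abs_of_pos (inv_pos.2 (hDpos A))]
    have h1 := (hDd A).1
    have h0 : 0 ≤ infDist A S := infDist_nonneg
    calc _ ≤ C * (η * ((D A)⁻¹ * ‖B‖)) * D A := by
          have := hDB A B
          have := hC (φ A)
          have := hDpos A
          gcongr
      _ = C * η * ‖B‖ := by field_simp [(hDpos A).ne']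
      _ ≤ _ := by gcongr

end Cutoff

/-! ### Gluing into a global uniformly elliptic function -/

theorem continuous_rankOne : Continuous (rankOne : E n → SymForm n) := by
  refine Continuous.subtype_mk ?_ _
  exact ((ContinuousLinearMap.smulRightL ℝ (E n) (E n →L[ℝ] ℝ)).continuous.comp
    (innerSL ℝ).continuous).clm_apply (innerSL ℝ).continuous

theorem rankOne_zero : rankOne (0 : E n) = 0 := by
  apply ext_qf; simp

theorem UniformlyElliptic.of_unit {F : SymForm n → ℝ} {a b : ℝ} (ha : 0 < a)
    (h : ∀ (A : SymForm n) (ξ : E n), ‖ξ‖ = 1 →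
      a ≤ fderiv ℝ F A (rankOne ξ) ∧ fderiv ℝ F A (rankOne ξ) ≤ b) : UniformlyElliptic F := by
  refine ⟨max 1 (max b a⁻¹), le_max_left _ _, fun A ξ => ?_⟩
  rcases eq_or_ne ξ 0 with rfl | hξ
  · rw [rankOne_zero, map_zero]; simp
  have hn := norm_pos_iff.2 hξ
  have h1 := h A (‖ξ‖⁻¹ • ξ) (by rw [norm_smul, norm_inv, norm_norm, inv_mul_cancel₀ hn.ne'])
  have h2 : fderiv ℝ F A (rankOne ξ) = ‖ξ‖ ^ 2 * fderiv ℝ F A (rankOne (‖ξ‖⁻¹ • ξ)) := by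
    rw [rankOne_smul, map_smul, smul_eq_mul]; field_simp
  have h3 : (max 1 (max b a⁻¹))⁻¹ ≤ a :=
    inv_le_of_inv_le₀ ha ((le_max_right _ _).trans (le_max_right _ _))
  have h4 : b ≤ max 1 (max b a⁻¹) := (le_max_left _ _).trans (le_max_right _ _)
  rw [h2, mul_comm (‖ξ‖ ^ 2)]
  have hp : 0 ≤ ‖ξ‖ ^ 2 := by positivity
  exact ⟨mul_le_mul_of_nonneg_right (h3.trans h1.1) hp,
    mul_le_mul_of_nonneg_right (h1.2.trans h4) hp⟩

theorem exists_ellipticity_near (hn : 0 < n) {S : Set (SymForm n)} (hS : IsCompact S)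
    (hne : S.Nonempty) {f : SymForm n → ℝ} (hf : ContDiff ℝ ∞ f) (hcs : HasCompactSupport f)
    (hpos : ∀ A ∈ S, ∀ ξ, ξ ≠ 0 → 0 < fderiv ℝ f A (rankOne ξ)) :
    ∃ κ r : ℝ, 0 < κ ∧ 0 < r ∧ ∀ A, infDist A S < r → ∀ ξ : E n, ‖ξ‖ = 1 →
      κ ≤ fderiv ℝ f A (rankOne ξ) := by
  have : Nonempty (Fin n) := ⟨⟨0, hn⟩⟩
  have hsph : (sphere (0 : E n) 1).Nonempty := NormedSpace.sphere_nonempty.2 zero_le_one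
  have hcd : Continuous (fderiv ℝ f) := hf.continuous_fderiv (by simp)
  have hc : Continuous fun p : SymForm n × E n => fderiv ℝ f p.1 (rankOne p.2) :=
    (hcd.comp continuous_fst).clm_apply (continuous_rankOne.comp continuous_snd)
  obtain ⟨⟨A₀, ξ₀⟩, ⟨hA₀, hξ₀⟩, hmin⟩ := (hS.prod (isCompact_sphere (0 : E n) 1)).exists_isMinOn
    (hne.prod hsph) hc.continuousOn
  set m := fderiv ℝ f A₀ (rankOne ξ₀) with hm
  have hm0 : 0 < m := hpos A₀ hA₀ ξ₀ (ne_of_mem_sphere hξ₀ one_ne_zero)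
  obtain ⟨r, hr, hrd⟩ := exists_fderiv_le_fderiv hf hcs (half_pos hm0)
  refine ⟨m / 2, r, half_pos hm0, hr, fun A hA ξ hξ => ?_⟩
  obtain ⟨B, hB, hAB⟩ := hS.exists_infDist_eq_dist hne A
  have h1 := hrd A B (hAB ▸ hA) (rankOne ξ)
  have h2 : m ≤ fderiv ℝ f B (rankOne ξ) :=
    isMinOn_iff.1 hmin (B, ξ) ⟨hB, by simpa using hξ⟩
  have h3 := norm_rankOne_le ξ
  rw [hξ, one_pow] at h3
  have h4 := mul_le_mul_of_nonneg_left h3 (half_pos hm0).le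
  linarith

/-- Gluing of a smooth function which is elliptic near a compact set `S` on which it vanishes with
a regularization of a Lipschitz elliptic function vanishing on `S`. -/
theorem exists_uniformlyElliptic (hn : 0 < n) {S : Set (SymForm n)} (hS : IsCompact S)
    (hne : S.Nonempty) {F₀ F₁ : SymForm n → ℝ} (hF₀ : ContDiff ℝ ∞ F₀)
    (hcs : HasCompactSupport F₀) (hS₀ : ∀ A ∈ S, F₀ A = 0)
    (hpos : ∀ A ∈ S, ∀ ξ, ξ ≠ 0 → 0 < fderiv ℝ F₀ A (rankOne ξ)) {L : NNReal} {M : ℝ}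
    (hF₁ : LipschitzWith L F₁) (hS₁ : ∀ A ∈ S, F₁ A = 0)
    (hell : ∀ ξ : E n, ‖ξ‖ = 1 → ∀ t : ℝ, 0 ≤ t → ∀ A,
      t ≤ F₁ (A + t • rankOne ξ) - F₁ A ∧ F₁ (A + t • rankOne ξ) - F₁ A ≤ M * t) :
    ∃ F : SymForm n → ℝ, ContDiff ℝ ∞ F ∧ UniformlyElliptic F ∧ ∀ A ∈ S, F A = 0 := by
  obtain ⟨κ, r, hκ, hr, hκr⟩ := exists_ellipticity_near hn hS hne hF₀ hcs hpos
  obtain ⟨K, hK⟩ := hF₀.lipschitzWith_of_hasCompactSupport hcs (by simp)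
  have hK0 : 0 ≤ (K : ℝ) := K.2
  have hL0 : 0 ≤ (L : ℝ) := L.2
  set κ' := min κ 1 with hκ'
  have hκ'0 : 0 < κ' := lt_min hκ one_pos
  -- Chosen so that the derivative of the cutoff costs at most half of the common ellipticity
  -- constant κ'.
  set ε := κ' / 2 / (K + L + 1) with hε
  have hε0 : 0 < ε := by positivity
  have hεK : (K + L) * ε ≤ κ' / 2 := by
    rw [hε, mul_div_assoc', div_le_iff₀ (by positivity)]; nlinarith
  obtain ⟨χ, ρ, hρ, hχ, hχ01, hχS, hχr, hχd⟩ := exists_cutoff (S := S) hr hε0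
  obtain ⟨G, hG, hGF, hGd⟩ := exists_smooth_approx hF₁ hρ
  -- Both F₀ and F₁ vanish at the nearest point of S, and G differs from F₁ by at most Lρ.
  have hdist : ∀ A, |F₀ A - G A| ≤ (K + L) * (infDist A S + ρ) := by
    intro A
    obtain ⟨B, hB, hAB⟩ := hS.exists_infDist_eq_dist hne A
    have h1 := hK.dist_le_mul A B
    have h2 := hF₁.dist_le_mul A B
    rw [hS₀ B hB, Real.dist_eq, sub_zero] at h1
    rw [hS₁ B hB, Real.dist_eq, sub_zero] at h2
    rw [← hAB] at h1 h2
    have h3 := hGF A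
    have h4 : |F₀ A - G A| ≤ |F₀ A| + (|F₁ A| + |G A - F₁ A|) := by
      have : F₀ A - G A = F₀ A + (-F₁ A + -(G A - F₁ A)) := by ring
      rw [this]
      refine (abs_add_le _ _).trans (add_le_add_right ((abs_add_le _ _).trans ?_) _)
      rw [abs_neg, abs_neg]
    nlinarith [mul_nonneg hK0 hρ.le]
  have hGell : ∀ A, ∀ ξ : E n, ‖ξ‖ = 1 →
      1 ≤ fderiv ℝ G A (rankOne ξ) ∧ fderiv ℝ G A (rankOne ξ) ≤ M := by
    intro A ξ hξ
    refine fderiv_bounds (hG.differentiable (by simp) A) fun t ht => ?_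
    refine hGd _ _ _ (fun C => ?_) A
    have := hell ξ hξ t ht C
    rwa [mul_one, mul_comm]
  let F : SymForm n → ℝ := fun A => χ A * F₀ A + (1 - χ A) * G A
  -- The first two terms form a convex combination of elliptic derivatives wherever χ ≠ 0 or 1 - χ ≠
  -- 0 gives them weight; the last term is the gluing error.
  have hF : ∀ A B, fderiv ℝ F A B = χ A * fderiv ℝ F₀ A B + (1 - χ A) * fderiv ℝ G A B +
      fderiv ℝ χ A B * (F₀ A - G A) := by
    intro A B
    have d1 := (hχ.differentiable (by simp) A).hasFDerivAt
    have d2 := (hF₀.differentiable (by simp) A).hasFDerivAt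
    have d3 := (hG.differentiable (by simp) A).hasFDerivAt
    have d : HasFDerivAt F _ A := (d1.mul d2).add ((d1.const_sub 1).mul d3)
    rw [d.fderiv]
    simp only [add_apply, smul_apply, neg_apply, smul_eq_mul]
    ring
  refine ⟨F, (hχ.mul hF₀).add ((contDiff_const.sub hχ).mul hG),
    .of_unit (a := κ' / 2) (b := K + M + κ' / 2) (half_pos hκ'0) fun A ξ hξ => ?_,
    fun A hA => by simp only [F, hχS A hA, hS₀ A hA]; ring⟩
  have hξ1 := norm_rankOne_le ξ
  rw [hξ, one_pow] at hξ1
  obtain ⟨hχ0, hχ1⟩ := hχ01 A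
  obtain ⟨g1, g2⟩ := hGell A ξ hξ
  have hd0 : 0 ≤ infDist A S := infDist_nonneg
  have herr : |fderiv ℝ χ A (rankOne ξ) * (F₀ A - G A)| ≤ κ' / 2 := by
    rw [abs_mul]
    calc _ ≤ |fderiv ℝ χ A (rankOne ξ)| * ((K + L) * (infDist A S + ρ)) := by
          have := hdist A
          gcongr
      _ = (K + L) * (|fderiv ℝ χ A (rankOne ξ)| * (infDist A S + ρ)) := by ring
      _ ≤ (K + L) * (ε * ‖rankOne ξ‖) := by
          have := hχd A (rankOne ξ)
          gcongr
      _ ≤ (K + L) * (ε * 1) := by gcongr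
      _ ≤ _ := by rwa [mul_one]
  have herr' := abs_le.1 herr
  have hup : fderiv ℝ F₀ A (rankOne ξ) ≤ K := by
    have h1 := (abs_le.1 ((fderiv ℝ F₀ A).le_opNorm (rankOne ξ))).2
    have h2 := mul_le_mul (norm_fderiv_le_of_lipschitz ℝ hK (x₀ := A)) hξ1 (norm_nonneg _) hK0
    linarith
  have hlow : χ A * κ' ≤ χ A * fderiv ℝ F₀ A (rankOne ξ) := by
    rcases lt_or_ge (infDist A S) r with h | h
    · exact mul_le_mul_of_nonneg_left ((min_le_left _ _).trans (hκr A h ξ hξ)) hχ0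
    · rw [hχr A h, zero_mul, zero_mul]
  have h1 := mul_le_mul_of_nonneg_left hup hχ0
  have h2 := mul_le_mul_of_nonneg_left g2 (sub_nonneg.2 hχ1)
  have h3 := mul_le_mul_of_nonneg_left ((min_le_right κ 1).trans g1) (sub_nonneg.2 hχ1)
  have h4 := mul_le_mul_of_nonneg_right hχ1 hK0
  have h5 := mul_le_mul_of_nonneg_right (show 1 - χ A ≤ 1 by linarith)
    (zero_le_one.trans (g1.trans g2))
  rw [← hκ'] at h3
  rw [hF]
  constructor <;> linarith

theorem HyperbolicMap.exists_uniformlyElliptic {H : E n → SymForm n} {c : ℝ}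
    (hH : HyperbolicMap H c) (hn : 0 < n) :
    ∃ F : SymForm n → ℝ, ContDiff ℝ ∞ F ∧ UniformlyElliptic F ∧ ∀ x ≠ 0, F (H x) = 0 := by
  have : Nonempty (Fin n) := ⟨⟨0, hn⟩⟩
  have hsph : (sphere (0 : E n) 1).Nonempty := NormedSpace.sphere_nonempty.2 zero_le_one
  have hloc : LocallyLipschitzOn (sphere (0 : E n) 1) H := fun x hx => by
    obtain ⟨C, U, hU, hC⟩ := ((hH.smooth x (ne_of_mem_sphere hx one_ne_zero)).of_le
      le_top : ContDiffAt ℝ 1 H x).exists_lipschitzOnWith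
    exact ⟨C, U, mem_nhdsWithin_of_mem_nhds hU, hC⟩
  obtain ⟨C, hC⟩ := hloc.exists_lipschitzOnWith_of_compact (isCompact_sphere _ _)
  have hC1 : 0 < (C : ℝ) + 1 := by positivity
  obtain ⟨F₀, h1, h2, h3, h4⟩ := hH.exists_smooth_elliptic_near
  obtain ⟨F₁, L, M, h5, h6, h7⟩ := exists_lipschitz_elliptic hn hH.isCompact_image
    -- Hyperbolicity is measured in |x - y|; the Lipschitz bound for H on the sphere converts it to
    -- ‖H x - H y‖, at the cost of dividing c by C + 1.
    (hsph.image H) (div_pos hH.pos hC1) (by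
      rintro _ ⟨x, hx, rfl⟩ _ ⟨y, hy, rfl⟩
      obtain ⟨v, hv, h⟩ := hH.hyp x y (by simpa using hx) (by simpa using hy)
      refine ⟨v, hv, ?_⟩
      have h' : ‖H x - H y‖ ≤ C * ‖x - y‖ := by
        rw [← dist_eq_norm, ← dist_eq_norm]; exact hC.dist_le_mul x hx y hy
      rw [qf_sub, div_mul_eq_mul_div, div_le_iff₀ hC1]
      nlinarith [mul_le_mul_of_nonneg_left h' hH.pos.le, mul_le_mul_of_nonneg_right h hC1.le,
        mul_nonneg hH.pos.le (norm_nonneg (x - y))])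
  obtain ⟨F, hF, hFe, hFS⟩ := FullyNonlinear.exists_uniformlyElliptic hn hH.isCompact_image
    (hsph.image H) h1 h2 h3 h4 h5 h6 h7
  refine ⟨F, hF, hFe, fun x hx => ?_⟩
  have hx' := norm_pos_iff.2 hx
  rw [← hH.hom ‖x‖⁻¹ (inv_pos.2 hx') x]
  refine hFS _ ⟨_, ?_, rfl⟩
  rw [mem_sphere_zero_iff_norm, norm_smul, norm_inv, norm_norm, inv_mul_cancel₀ hx'.ne']

/-! ### Application to `w` -/

/-- Symmetrization of bilinear forms. -/
def symmL : (E n →L[ℝ] E n →L[ℝ] ℝ) →L[ℝ] SymForm n :=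
  LinearMap.toContinuousLinearMap
    { toFun := fun B => ⟨(1 / 2 : ℝ) • (B + B.flip), fun y z => by simp [add_comm]⟩
      map_add' := fun B C => by apply ext_qf; intro v; simp [qf_apply]; ring
      map_smul' := fun c B => by apply ext_qf; intro v; simp [qf_apply]; ring }

theorem contDiffAt_hess {u : E n → ℝ} {x : E n} (hu : ContDiffAt ℝ ω u x) :
    ContDiffAt ℝ ω (hess u) x := by
  have h : ContDiffAt ℝ ω (fderiv ℝ (fderiv ℝ u)) x :=
    (hu.fderiv_right (m := ω) le_top).fderiv_right (m := ω) le_top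
  exact (symmL (n := n)).contDiff.contDiffAt.comp x h

theorem exists_hyperbolicMap_w : ∃ c, HyperbolicMap (hess w) c := by
  obtain ⟨c, hc, h⟩ := hess_w_hyperbolic
  exact ⟨c, fun x hx => contDiffAt_hess
      (contDiff_cub.contDiffAt.div (contDiffAt_norm ℝ hx) (norm_ne_zero_iff.2 hx)),
    fun t ht x => hess_smul_arg ht (profile_w.hom t ht) x, hc, h⟩

/-- If the Hessian vanished at a unit vector e it would vanish at -e as well, against hyperbolicity
for this antipodal pair. -/
theorem exists_hess_w_ne_zero : ∃ e : E 12, e ≠ 0 ∧ hess w e ≠ 0 := by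
  obtain ⟨c, hc, h⟩ := hess_w_hyperbolic
  obtain ⟨e, he⟩ : (sphere (0 : E 12) 1).Nonempty := NormedSpace.sphere_nonempty.2 zero_le_one
  have he0 : e ≠ 0 := ne_of_mem_sphere he one_ne_zero
  have he1 : ‖e‖ = 1 := by simpa using he
  refine ⟨e, he0, fun h0 => ?_⟩
  obtain ⟨v, -, hv⟩ := h e (-e) he1 (by rwa [norm_neg])
  rw [profile_w.hess_neg_arg he0, h0] at hv
  rw [sub_neg_eq_add, ← two_smul ℝ e, norm_smul, he1] at hv
  simp at hv
  linarith

end FullyNonlinear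

end

theorem mainTheorem2 :
    (ContDiffOn ℝ ∞ FullyNonlinear.w {0}ᶜ ∧
      ¬ ∃ L : FullyNonlinear.SymForm 12,
        Tendsto (FullyNonlinear.hess FullyNonlinear.w) (𝓝[≠] (0 : FullyNonlinear.E 12)) (𝓝 L)) ∧
    ∃ F : FullyNonlinear.SymForm 12 → ℝ,
      ContDiff ℝ ∞ F ∧ FullyNonlinear.UniformlyElliptic F ∧
      FullyNonlinear.IsViscosityDirichletSolution F (ball 0 1)
        FullyNonlinear.w FullyNonlinear.w ∧
      (∀ v : FullyNonlinear.E 12 → ℝ,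
        FullyNonlinear.IsViscosityDirichletSolution F (ball 0 1) FullyNonlinear.w v →
          EqOn v FullyNonlinear.w (closedBall 0 1)) ∧
      ¬ ∃ u : FullyNonlinear.E 12 → ℝ,
        FullyNonlinear.IsClassicalDirichletSolution F (ball 0 1) FullyNonlinear.w u := by

  obtain ⟨e, he, hne⟩ := FullyNonlinear.exists_hess_w_ne_zero
  obtain ⟨c, hH⟩ := FullyNonlinear.exists_hyperbolicMap_w
  obtain ⟨F, hF, hFe, hFw⟩ := hH.exists_uniformlyElliptic (by norm_num)
  have hE := hFe.elliptic (hF.differentiable (by simp))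
  have hw := FullyNonlinear.profile_w
  exact ⟨⟨hw.smooth, hw.not_tendsto_hess he hne⟩, F, hF, hFe,
    ⟨hw.isViscositySolution hE hFw isOpen_ball, hw.continuous.continuousOn, fun _ _ => rfl⟩,
    fun v hv => hw.eqOn_of_isViscosityDirichletSolution hE hFw hv,
    hw.not_isClassicalDirichletSolution hE hFw he hne⟩
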